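/- Conventions. A modular tensor category $\mathcal C$ is a braided fusion category over $\mathbb C$ (a $\mathbb C$-linear abelian rigid braided monoidal category with bilinear tensor product, simple tensor unit $\mathbf 1$, finite-dimensional morphism spaces, all objects projective and finitely many isomorphism classes of simple objects) with a ribbon twist, such that every object that has trivial monodromy with all objects is a finite direct sum of copies of $\mathbf 1$. The quantum dimension of an object is its categorical trace dimension defined by the ribbon structure. A surface defect separating $\mathcal C$ from itself is a left $\mathcal C$-module category $S$ which is abelian and $\mathbb C$-linear, with bilinear action, finite-dimensional morphism spaces, all objects projective and finitely many isomorphism classes of simple objects. It is called special if the space of module natural endotransformations of $\mathrm{Id}_S$ is isomorphic to $\mathbb C$. A Wilson line is a $\mathcal C$-module functor $M\colon S\to\mathcal C$, where $\mathcal C$ is regarded as a module category over itself; it is non-zero if $M(s)\neq 0$ for some $s\in S$, and non-degenerate if $M(s)\ne 0$ for all $s\neq 0$. Adjunctions are those in the bicategory of $\mathcal C$-module categories: their units and counits are module natural transformations. Given $\bar M\colon\mathcal C\to S$ with adjunctions $\bar M\dashv M$ and $M\dashv\bar M$, let $A^M=M\circ\bar M$, viewed as the object $M(\bar M(\mathbf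 1))$ of $\mathcal C$ through the equivalence $F\mapsto F(\mathbf 1)$ of the category of module endofunctors of $\mathcal C$ with $\mathcal C$. Its product is given by $M\circ(\bar M M\Rightarrow \mathrm{Id}_S)\circ\bar M$, its unit by $\mathrm{Id}_{\mathcal C}\Rightarrow M\bar M$ (counit and unit of $\bar M\dashv M$), its coproduct by $M\circ(\mathrm{Id}_S\Rightarrow\bar MM)\circ\bar M$ and its counit by $M\bar M\Rightarrow\mathrm{Id}_{\mathcal C}$ (unit and counit of $M\dashv\bar M$). An algebra and coalgebra $A$ is called special if $m\circ\Delta=\beta_A\,\mathrm{id}_A$ and $\varepsilon\circ\eta=\beta_1\,\mathrm{id}_{\mathbf 1}$ with $\beta_A,\beta_1\in\mathbb C\setminus\{0\}$; a Frobenius algebra $A$ is symmetric if the two morphisms $A\to A^\vee$ obtained from $\varepsilon\circ m$ by means of the right and the left duality coincide. Algebras $A$, $B$ are Morita equivalent if there are an $A$-$B$-bimodule $P$ and a $B$-$A$-bimodule $Q$ with $P\otimes_BQ\cong A$ and $Q\otimes_AP\cong B$ as bimodules. Theorem. Let $\mathcal C$ be a modular tensor category in which every non-zero object has non-zero quantum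 dimension, and $S$ a surface defect separating $\mathcal C$ from itself. 1. There is a non-degenerate Wilson line $M\colon S\to\mathcal C$. 2. Every Wilson line $M$ has a biadjoint module functor $\bar M$. 3. For every Wilson line $M$ and any choice of $\bar M$ and of adjunctions $\bar M\dashv M$, $M\dashv\bar M$, the object $A^M$ is a Frobenius algebra in $\mathcal C$. 4. If $M$ is non-zero, then for any $\bar M$ and any adjunction $\bar M\dashv M$ there is an adjunction $M\dashv\bar M$ such that $A^M$ is a special symmetric Frobenius algebra. If moreover $S$ is special, then $A^M$ is special for every choice of the two adjunctions for which it is symmetric. 5. If $S$ is special, then for any two non-zero Wilson lines $M,M'\colon S\to\mathcal C$ (and any choices of biadjoints and adjunctions) the algebras $A^M$ and $A^{M'}$ are Morita equivalent. For arbitrary $S$ the same holds for any two non-degenerate Wilson lines. Thus $S$ determines a Morita equivalence class of special symmetric Frobenius algebras in $\mathcal C$ (for $S\neq 0$). -/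

import Mathlib

open CategoryTheory MonoidalCategory Limits

universe v u v₁ u₁ v₂ u₂ v₃ u₃

namespace SurfaceDefect

section Categories

attribute [local instance] Abelian.hasFiniteBiproducts

/-- A `ℂ`-linear abelian category is finitely semisimple if all its objects are projective, it has
finitely many simple objects up to isomorphism, and all its morphism spaces are
finite-dimensional. -/
class FinitelySemisimple (C : Type u) [Category.{v} C] [Abelian C] [Linear ℂ C] : Prop where
  projective (X : C) : Projective X
  finite_simples : ∃ (n : ℕ) (L : Fin n → C), ∀ X : C, Simple X → ∃ i, Nonempty (X ≅ L i)
  finite_hom (X Y : C) : Module.Finite ℂ (X ⟶ Y)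

/-- A modular tensor category: a braided fusion category over `ℂ` (finitely semisimple, rigid,
with simple tensor unit and bilinear tensor product), equipped with a ribbon twist, such that
every object that has trivial monodromy with all objects is a finite direct sum of copies of the
tensor unit. -/
class ModularTensorCategory (C : Type u) [Category.{v} C] [Abelian C] [Linear ℂ C]
    [MonoidalCategory C] [MonoidalPreadditive C] [MonoidalLinear ℂ C] [BraidedCategory C]
    [RigidCategory C] where
  finitelySemisimple : FinitelySemisimple C
  simple_unit : Simple (𝟙_ C)
  /-- The twist. -/
  twist (X : C) : X ≅ X
  twist_naturality {X Y : C} (f : X ⟶ Y) : f ≫ (twist Y).hom = (twist X).hom ≫ f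
  twist_tensor (X Y : C) : (twist (X ⊗ Y)).hom =
    ((twist X).hom ⊗ₘ (twist Y).hom) ≫ (β_ X Y).hom ≫ (β_ Y X).hom
  twist_dual (X : C) : (twist (Xᘁ)).hom = ((twist X).hom)ᘁ
  nondegenerate (X : C) (hX : ∀ Y : C, (β_ X Y).hom ≫ (β_ Y X).hom = 𝟙 (X ⊗ Y)) :
    ∃ n : ℕ, Nonempty (X ≅ ⨁ fun _ : Fin n => 𝟙_ C)

end Categories

section Duality

variable {C : Type u} [Category.{v} C] [Abelian C] [Linear ℂ C]
  [MonoidalCategory C] [MonoidalPreadditive C] [MonoidalLinear ℂ C] [BraidedCategory C]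
  [RigidCategory C] [ModularTensorCategory C]

open ModularTensorCategory

/-- The coevaluation `𝟙 ⟶ Xᘁ ⊗ X` which exhibits the right dual `Xᘁ` also as a left dual. -/
def coev' (X : C) : 𝟙_ C ⟶ Xᘁ ⊗ X :=
  η_ X Xᘁ ≫ (β_ X Xᘁ).hom ≫ Xᘁ ◁ (twist X).hom

/-- The evaluation `X ⊗ Xᘁ ⟶ 𝟙` which exhibits the right dual `Xᘁ` also as a left dual. -/
def ev' (X : C) : X ⊗ Xᘁ ⟶ 𝟙_ C :=
  (twist X).hom ▷ Xᘁ ≫ (β_ X Xᘁ).hom ≫ ε_ X Xᘁ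

/-- The quantum dimension of `X`, as an endomorphism of the tensor unit (that is, a scalar). -/
def qdim (X : C) : 𝟙_ C ⟶ 𝟙_ C := η_ X Xᘁ ≫ ev' X

end Duality

section Algebras

variable {C : Type u} [Category.{v} C] [MonoidalCategory C]

/-- An object with candidates for a product, a unit, a coproduct and a counit. -/
structure FrobeniusData (C : Type u) [Category.{v} C] [MonoidalCategory C] where
  /-- The underlying object. -/
  X : C
  /-- The product. -/
  mul : X ⊗ X ⟶ X
  /-- The unit. -/
  one : 𝟙_ C ⟶ X
  /-- The coproduct. -/
  comul : X ⟶ X ⊗ X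
  /-- The counit. -/
  counit : X ⟶ 𝟙_ C

namespace FrobeniusData

/-- The product is associative and unital. -/
structure IsAlgebra (A : FrobeniusData C) : Prop where
  one_mul : A.one ▷ A.X ≫ A.mul = (λ_ A.X).hom
  mul_one : A.X ◁ A.one ≫ A.mul = (ρ_ A.X).hom
  assoc : A.mul ▷ A.X ≫ A.mul = (α_ A.X A.X A.X).hom ≫ A.X ◁ A.mul ≫ A.mul

/-- The coproduct is coassociative and counital. -/
structure IsCoalgebra (A : FrobeniusData C) : Prop where
  counit_comul : A.comul ≫ A.counit ▷ A.X = (λ_ A.X).inv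
  comul_counit : A.comul ≫ A.X ◁ A.counit = (ρ_ A.X).inv
  coassoc : A.comul ≫ A.comul ▷ A.X ≫ (α_ A.X A.X A.X).hom = A.comul ≫ A.X ◁ A.comul

/-- A Frobenius algebra: an algebra and coalgebra whose coproduct is a morphism of bimodules. -/
structure IsFrobenius (A : FrobeniusData C) : Prop extends A.IsAlgebra, A.IsCoalgebra where
  comul_left : A.X ◁ A.comul ≫ (α_ A.X A.X A.X).inv ≫ A.mul ▷ A.X = A.mul ≫ A.comul
  comul_right : A.comul ▷ A.X ≫ (α_ A.X A.X A.X).hom ≫ A.X ◁ A.mul = A.mul ≫ A.comul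

/-- The underlying algebra as a monoid object. -/
def toMon (A : FrobeniusData C) (h : A.IsAlgebra) : Mon C where
  X := A.X
  mon :=
    { one := A.one
      mul := A.mul
      one_mul := h.one_mul
      mul_one := h.mul_one
      mul_assoc := h.assoc }

/-- Special: product after coproduct is a non-zero multiple of the identity of `A`, and counit after
unit is a non-zero multiple of the identity of the tensor unit. -/
def IsSpecial [Preadditive C] [Linear ℂ C] (A : FrobeniusData C) : Prop :=
  (∃ b : ℂ, b ≠ 0 ∧ A.comul ≫ A.mul = b • 𝟙 A.X) ∧
    ∃ b : ℂ, b ≠ 0 ∧ A.one ≫ A.counit = b • 𝟙 (𝟙_ C)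

/-- Symmetric: the two morphisms `A ⟶ Aᘁ` obtained from the pairing
`counit ∘ mul : A ⊗ A ⟶ 𝟙` by means of the duality `(Aᘁ, coev, ev)` and of the duality
`(Aᘁ, coev', ev')` coincide. -/
def IsSymmetric {C : Type u} [Category.{v} C] [Abelian C] [Linear ℂ C]
    [MonoidalCategory C] [MonoidalPreadditive C] [MonoidalLinear ℂ C] [BraidedCategory C]
    [RigidCategory C] [ModularTensorCategory C] (A : FrobeniusData C) : Prop :=
  (ρ_ A.X).inv ≫ A.X ◁ η_ A.X A.Xᘁ ≫ (α_ A.X A.X A.Xᘁ).inv ≫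
      (A.mul ≫ A.counit) ▷ A.Xᘁ ≫ (λ_ A.Xᘁ).hom =
    (λ_ A.X).inv ≫ coev' A.X ▷ A.X ≫ (α_ A.Xᘁ A.X A.X).hom ≫
      A.Xᘁ ◁ (A.mul ≫ A.counit) ≫ (ρ_ A.Xᘁ).hom

end FrobeniusData

section Morita

variable [RigidCategory C]

instance preservesColimits_tensorLeft (X : C) :
    PreservesColimitsOfSize.{0, 0} (tensorLeft X) :=
  (tensorLeftAdjunction (ᘁX) X).leftAdjoint_preservesColimits

instance preservesColimits_tensorRight (X : C) :
    PreservesColimitsOfSize.{0, 0} (tensorRight X) :=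
  (tensorRightAdjunction X Xᘁ).leftAdjoint_preservesColimits

/-- Two algebras `A`, `B` in `C` are Morita equivalent if there are an `A`-`B`-bimodule `P` and a
`B`-`A`-bimodule `Q` with `P ⊗_B Q ≅ A` and `Q ⊗_A P ≅ B` as bimodules. -/
def MoritaEquivalent [HasCoequalizers C] (A B : Mon C) : Prop :=
  ∃ (P : Bimod A B) (Q : Bimod B A),
    Nonempty (P.tensorBimod Q ≅ Bimod.regular A) ∧ Nonempty (Q.tensorBimod P ≅ Bimod.regular B)

end Morita

end Algebras

section ModuleCategories

open MonoidalLeftAction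
open Functor.LaxLeftLinear Functor.OplaxLeftLinear Functor.LeftLinear

/-- The action functor of a (left) module category is `ℂ`-bilinear on morphisms. For finitely
semisimple categories, where every short exact sequence splits, it is then exact in each
variable. -/
class BilinearAction (C : Type u) [Category.{v} C] [Preadditive C] [Linear ℂ C]
    [MonoidalCategory C] (S : Type u₁) [Category.{v₁} S] [Preadditive S] [Linear ℂ S]
    [MonoidalLeftAction C S] : Prop where
  add_actionHomLeft {c c' : C} (f g : c ⟶ c') (s : S) : (f + g) ⊵ₗ s = f ⊵ₗ s + g ⊵ₗ s
  smul_actionHomLeft (z : ℂ) {c c' : C} (f : c ⟶ c') (s : S) : (z • f) ⊵ₗ s = z • (f ⊵ₗ s)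
  actionHomRight_add (c : C) {s s' : S} (f g : s ⟶ s') : c ⊴ₗ (f + g) = c ⊴ₗ f + c ⊴ₗ g
  actionHomRight_smul (z : ℂ) (c : C) {s s' : S} (f : s ⟶ s') : c ⊴ₗ (z • f) = z • (c ⊴ₗ f)

variable (C : Type u) [Category.{v} C] [MonoidalCategory C]

section Linear

variable {D : Type u₁} [Category.{v₁} D] [MonoidalLeftAction C D]
  {E : Type u₂} [Category.{v₂} E] [MonoidalLeftAction C E]
  {E' : Type u₃} [Category.{v₃} E'] [MonoidalLeftAction C E']

/-- The identity module functor. -/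
instance idLeftLinear : (𝟭 D).LeftLinear C where
  μₗ _ _ := 𝟙 _
  δₗ _ _ := 𝟙 _
  μₗ_comp_δₗ _ _ := by simp
  δₗ_comp_μₗ _ _ := by simp

/-- The composition of module functors. -/
instance compLeftLinear (F : D ⥤ E) [F.LeftLinear C] (G : E ⥤ E') [G.LeftLinear C] :
    (F ⋙ G).LeftLinear C where
  μₗ c d := μₗ G c (F.obj d) ≫ G.map (μₗ F c d)
  μₗ_naturality_left f d := by simp [← Functor.map_comp]
  μₗ_naturality_right c _ _ f := by simp [← Functor.map_comp]
  μₗ_associativity c c' d := by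
    rw [Category.assoc, Functor.comp_map, ← Functor.map_comp, μₗ_associativity F]
    simp
  μₗ_unitality d := by simp [← Functor.map_comp]
  δₗ c d := G.map (δₗ F c d) ≫ δₗ G c (F.obj d)
  δₗ_naturality_left f d := by
    rw [Functor.comp_map, ← Functor.map_comp_assoc, δₗ_naturality_left F]
    simp
  δₗ_naturality_right c _ _ f := by
    rw [Functor.comp_map, ← Functor.map_comp_assoc, δₗ_naturality_right F]
    simp
  δₗ_associativity c c' d := by
    have h := congrArg G.map (δₗ_associativity F c c' d)
    simp only [Functor.map_comp] at h
    simp only [Functor.comp_obj, Functor.comp_map, Category.assoc, δₗ_associativity,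
      actionHomRight_comp]
    rw [reassoc_of% h, δₗ_naturality_right_assoc G]
  δₗ_unitality_inv d := by
    rw [Functor.comp_map, ← Functor.map_comp_assoc, ← δₗ_unitality_inv F]
    exact δₗ_unitality_inv G (F.obj d)
  μₗ_comp_δₗ c d := by
    rw [Category.assoc, ← Functor.map_comp_assoc, μₗ_comp_δₗ F]
    simp
  δₗ_comp_μₗ c d := by simp [← Functor.map_comp]

/-- A natural transformation between module functors is a module natural transformation if it is
compatible with the action of `C`. -/
def IsModuleTransformation {F G : D ⥤ E} [F.LeftLinear C] [G.LeftLinear C] (α : F ⟶ G) : Prop :=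
  ∀ (c : C) (d : D), μₗ F c d ≫ α.app (c ⊙ₗ d) = c ⊴ₗ α.app d ≫ μₗ G c d

end Linear

/-- A module functor: an additive functor with coherent natural isomorphisms
`c ⊙ₗ F d ≅ F (c ⊙ₗ d)`. -/
structure ModuleFunctor (D : Type u₁) [Category.{v₁} D] [Preadditive D] [MonoidalLeftAction C D]
    (E : Type u₂) [Category.{v₂} E] [Preadditive E] [MonoidalLeftAction C E] where
  /-- The underlying functor. -/
  functor : D ⥤ E
  additive : functor.Additive
  /-- The structure isomorphisms. -/
  leftLinear : functor.LeftLinear C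

attribute [instance] ModuleFunctor.additive ModuleFunctor.leftLinear

/-- An adjunction `L ⊣ R` in the bicategory of module categories: an adjunction of the underlying
functors whose unit and counit are module natural transformations. -/
structure ModuleAdjunction {D : Type u₁} [Category.{v₁} D] [Preadditive D]
    [MonoidalLeftAction C D] {E : Type u₂} [Category.{v₂} E] [Preadditive E]
    [MonoidalLeftAction C E] (L : ModuleFunctor C D E) (R : ModuleFunctor C E D) extends
    L.functor ⊣ R.functor where
  unit_isModuleTransformation : IsModuleTransformation C toAdjunction.unit
  counit_isModuleTransformation : IsModuleTransformation C toAdjunction.counit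

/-- The space of module natural endotransformations of the identity functor of `S`. -/
def idEnd [Preadditive C] [Linear ℂ C] (S : Type u₁) [Category.{v₁} S] [Preadditive S] [Linear ℂ S]
    [MonoidalLeftAction C S] [BilinearAction C S] : Submodule ℂ (𝟭 S ⟶ 𝟭 S) where
  carrier := {α | IsModuleTransformation C α}
  add_mem' {α α'} h h' c s := by
    have h₁ := h c s
    have h₂ := h' c s
    rw [NatTrans.app_add, NatTrans.app_add, Preadditive.comp_add, h₁, h₂,
      BilinearAction.actionHomRight_add, Preadditive.add_comp]
  zero_mem' c s := by
    have h := BilinearAction.actionHomRight_smul (0 : ℂ) c (0 : s ⟶ s)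
    rw [zero_smul, zero_smul] at h
    rw [NatTrans.app_zero, NatTrans.app_zero, comp_zero]
    exact (by rw [h, zero_comp] :
      (0 : c ⊙ₗ s ⟶ c ⊙ₗ s) = c ⊴ₗ (0 : s ⟶ s) ≫ μₗ (𝟭 S) c s)
  smul_mem' z α h c s := by
    have h₁ := h c s
    rw [NatTrans.app_smul, NatTrans.app_smul, Linear.comp_smul, h₁,
      BilinearAction.actionHomRight_smul, Linear.smul_comp]

/-- A surface defect `S` is special if the space of module natural endotransformations of its
identity functor is isomorphic to `ℂ`. -/
def IsSpecialDefect [Preadditive C] [Linear ℂ C] (S : Type u₁) [Category.{v₁} S] [Preadditive S]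
    [Linear ℂ S] [MonoidalLeftAction C S] [BilinearAction C S] : Prop :=
  Nonempty (idEnd C S ≃ₗ[ℂ] ℂ)

variable {C} [Preadditive C] {S : Type u₁} [Category.{v₁} S] [Preadditive S]
  [MonoidalLeftAction C S]

/-- The Wilson line `M : S → C` is non-zero. -/
def ModuleFunctor.IsNonzero (M : ModuleFunctor C S C) : Prop := ∃ s : S, ¬ IsZero (M.functor.obj s)

/-- The Wilson line `M : S → C` annihilates no non-zero object of `S`. -/
def ModuleFunctor.IsNondegenerate (M : ModuleFunctor C S C) : Prop :=
  ∀ s : S, ¬ IsZero s → ¬ IsZero (M.functor.obj s)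

/-- For a module functor `M : S → C` and adjunctions `Mbar ⊣ M` and `M ⊣ Mbar` of module functors,
the module endofunctor `T = M ∘ Mbar` of `C`, regarded as an object of `C` by means of the
equivalence `T ↦ T(𝟙)` between module endofunctors of `C` and `C`, for which `T(T(𝟙))` corresponds
to `T(𝟙) ⊗ T(𝟙)` through the module structure of `T`. The product and unit of
`T` are `M ∘ (Mbar ∘ M ⇒ Id) ∘ Mbar` and `Id ⇒ M ∘ Mbar` (from `Mbar ⊣ M`), the coproduct and
counit are `M ∘ (Id ⇒ Mbar ∘ M) ∘ Mbar` and `M ∘ Mbar ⇒ Id` (from `M ⊣ Mbar`). -/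
def wilsonAlgebra (M : ModuleFunctor C S C) (Mbar : ModuleFunctor C C S)
    (l : ModuleAdjunction C Mbar M) (r : ModuleAdjunction C M Mbar) : FrobeniusData C :=
  let T : C ⥤ C := Mbar.functor ⋙ M.functor
  let A : C := T.obj (𝟙_ C)
  let i : A ⊗ A ≅ T.obj A := μₗIso T A (𝟙_ C) ≪≫ T.mapIso (ρ_ A)
  { X := A
    mul := i.hom ≫ M.functor.map (l.counit.app (Mbar.functor.obj (𝟙_ C)))
    one := l.unit.app (𝟙_ C)
    comul := M.functor.map (r.unit.app (Mbar.functor.obj (𝟙_ C))) ≫ i.inv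
    counit := r.counit.app (𝟙_ C) }

end ModuleCategories

end SurfaceDefect

open SurfaceDefect

/-!
# Wilson lines on surface defects and symmetric Frobenius algebras

The whole argument is carried out with internal Homs. A left adjoint `Mbar` of a Wilson line
`M : S ⥤ C` is the action on the object `m = Mbar (𝟙_ C)`, and the adjunction says that `M s` is the
internal Hom object `Hom(m, s)`; a right adjoint of `M` says that, dually, `M` is left adjoint to
the action on `m`. The structures `InnerHom` and `InnerCohom` record these two halves by their
evaluation and coevaluation. In these terms the algebra of the Wilson line is the internal
endomorphism object of `m` (`wilsonAlgebra_eq`). The Frobenius relations follow from the fact that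
evaluation and coevaluation are natural and compatible with the action
(`innerEnd_isFrobenius`).

*Existence.* In a finitely semisimple category universal arrows are obtained from weakly universal
ones with minimal target (`exists_universal`). This gives the internal Hom functor of a generator of
`S`, which is a nondegenerate Wilson line (`exists_nondegenerate`), and an object `m` with a
universal morphism `𝟙_ C ⟶ M m`. Rigidity of `C` turns a universal morphism `𝟙_ C ⟶ M m` or
`M m ⟶ 𝟙_ C` into a module adjunction (`leftAdjointOfUniversal`,
`exists_rightAdjoint_of_universal`).

*The canonical trace.* For the adjunction on the other side the counit `M m ⟶ 𝟙_ C` is taken to be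
the partial trace of the product of the internal endomorphism algebra (`traceForm`). The trace of an
idempotent of `m` is the quantum dimension of its image under `M`. Since quantum dimensions of
non-zero objects do not vanish and all morphisms of `S` have generalized inverses, the trace pairing
between `s ⟶ m` and `m ⟶ s` is nondegenerate, and the trace form is universal
(`bijective_map_comp_traceForm`). It is symmetric by cyclicity of the partial trace (`ptr_cyclic`),
which is where the ribbon structure enters: the pivotal structure is natural and monoidal
(`whiskerLeft_mate_evR`, `evR_tensor`).

*Specialness.* Product after coproduct is the value of `M` on `central m`, where `central` is the
module endotransformation of the identity given by coevaluation and evaluation. In every symmetric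
Frobenius algebra the composite of unit, coproduct, product and counit is the quantum dimension
(`one_comul_mul_counit`), so if `central m` is a scalar, neither this scalar nor the one given by
counit after unit vanishes. For the canonical trace `central m` is the identity (`central_eq_id`);
for a special surface defect `central` is always a scalar.

*Morita equivalence.* For `M = Hom(m, -)` and `M' = Hom(n, -)` the bimodules are `Hom(n, m)` and
`Hom(m, n)`. Composition `Hom(n, m) ⊗ Hom(m, n) ⟶ Hom(m, m)` is a split coequalizer as soon as the
evaluation `Hom(n, m) ⊙ n ⟶ m` has a section (`exists_splitting`). A section exists for a
nondegenerate Wilson line because `M'` annihilates the cokernel of the evaluation, and for a special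
surface defect because the canonical coevaluation is a section up to a non-zero scalar.
-/

namespace SurfaceDefect

open MonoidalLeftAction
open Functor.LaxLeftLinear Functor.OplaxLeftLinear Functor.LeftLinear

/-! ### Internal Hom functors of a module category -/

section InnerHom

variable {C : Type u} [Category.{v} C] [MonoidalCategory C]
  {S : Type u₁} [Category.{v₁} S] [MonoidalLeftAction C S]

/-- The structure isomorphism `c ⊗ F s ≅ F (c ⊙ s)` of a module functor `F : S ⥤ C`, written with
the tensor product of `C` in place of the action of `C` on itself. -/
def str (F : S ⥤ C) [F.LeftLinear C] (c : C) (s : S) : c ⊗ F.obj s ≅ F.obj (c ⊙ₗ s) :=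
  μₗIso F c s

section str

variable (F : S ⥤ C) [F.LeftLinear C]

lemma str_naturality_left {c c' : C} (f : c ⟶ c') (s : S) :
    f ▷ F.obj s ≫ (str F c' s).hom = (str F c s).hom ≫ F.map (f ⊵ₗ s) :=
  μₗ_naturality_left F f s

lemma str_naturality_left_assoc {c c' : C} (f : c ⟶ c') (s : S) {Z : C}
    (g : F.obj (c' ⊙ₗ s) ⟶ Z) :
    f ▷ F.obj s ≫ (str F c' s).hom ≫ g = (str F c s).hom ≫ F.map (f ⊵ₗ s) ≫ g :=
  (reassoc_of% (str_naturality_left F f s)) g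

lemma str_naturality_right (c : C) {s s' : S} (f : s ⟶ s') :
    c ◁ F.map f ≫ (str F c s').hom = (str F c s).hom ≫ F.map (c ⊴ₗ f) :=
  μₗ_naturality_right F c f

lemma str_naturality_right_assoc (c : C) {s s' : S} (f : s ⟶ s') {Z : C}
    (g : F.obj (c ⊙ₗ s') ⟶ Z) :
    c ◁ F.map f ≫ (str F c s').hom ≫ g = (str F c s).hom ≫ F.map (c ⊴ₗ f) ≫ g :=
  (reassoc_of% (str_naturality_right F c f)) g

lemma str_inv_naturality_left {c c' : C} (f : c ⟶ c') (s : S) :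
    F.map (f ⊵ₗ s) ≫ (str F c' s).inv = (str F c s).inv ≫ f ▷ F.obj s :=
  δₗ_naturality_left F f s

lemma str_inv_naturality_left_assoc {c c' : C} (f : c ⟶ c') (s : S) {Z : C}
    (g : c' ⊗ F.obj s ⟶ Z) :
    F.map (f ⊵ₗ s) ≫ (str F c' s).inv ≫ g = (str F c s).inv ≫ f ▷ F.obj s ≫ g :=
  (reassoc_of% (str_inv_naturality_left F f s)) g

lemma str_inv_naturality_right (c : C) {s s' : S} (f : s ⟶ s') :
    F.map (c ⊴ₗ f) ≫ (str F c s').inv = (str F c s).inv ≫ c ◁ F.map f :=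
  δₗ_naturality_right F c f

lemma str_inv_naturality_right_assoc (c : C) {s s' : S} (f : s ⟶ s') {Z : C}
    (g : c ⊗ F.obj s' ⟶ Z) :
    F.map (c ⊴ₗ f) ≫ (str F c s').inv ≫ g = (str F c s).inv ≫ c ◁ F.map f ≫ g :=
  (reassoc_of% (str_inv_naturality_right F c f)) g

lemma str_assoc (c c' : C) (s : S) :
    (str F (c ⊗ c') s).hom ≫ F.map (αₗ c c' s).hom =
      (α_ c c' (F.obj s)).hom ≫ c ◁ (str F c' s).hom ≫ (str F c (c' ⊙ₗ s)).hom :=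
  μₗ_associativity F c c' s

lemma str_assoc_assoc (c c' : C) (s : S) {Z : C} (g : F.obj (c ⊙ₗ c' ⊙ₗ s) ⟶ Z) :
    (str F (c ⊗ c') s).hom ≫ F.map (αₗ c c' s).hom ≫ g =
      (α_ c c' (F.obj s)).hom ≫ c ◁ (str F c' s).hom ≫ (str F c (c' ⊙ₗ s)).hom ≫ g :=
  (reassoc_of% (str_assoc F c c' s)) g

lemma str_inv_assoc (c c' : C) (s : S) :
    (str F (c ⊗ c') s).inv ≫ (α_ c c' (F.obj s)).hom =
      F.map (αₗ c c' s).hom ≫ (str F c (c' ⊙ₗ s)).inv ≫ c ◁ (str F c' s).inv :=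
  δₗ_associativity F c c' s

lemma str_inv_assoc_assoc (c c' : C) (s : S) {Z : C} (g : c ⊗ c' ⊗ F.obj s ⟶ Z) :
    (str F (c ⊗ c') s).inv ≫ (α_ c c' (F.obj s)).hom ≫ g =
      F.map (αₗ c c' s).hom ≫ (str F c (c' ⊙ₗ s)).inv ≫ c ◁ (str F c' s).inv ≫ g :=
  (reassoc_of% (str_inv_assoc F c c' s)) g

lemma str_unit (s : S) :
    (str F (𝟙_ C) s).hom ≫ F.map (λₗ s).hom = (λ_ (F.obj s)).hom :=
  (μₗ_unitality F s).symm

lemma str_inv_unit (s : S) :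
    F.map (λₗ s).inv ≫ (str F (𝟙_ C) s).inv = (λ_ (F.obj s)).inv :=
  (δₗ_unitality_inv F s).symm

end str

/-- A module functor `F : S ⥤ C` as the internal Hom functor `Hom(m, -)` of an object `m` of `S`:
the counit (evaluation) and the value at `𝟙_ C` of the unit of an adjunction `(- ⊙ m) ⊣ F` of
module functors. -/
structure InnerHom (F : S ⥤ C) [F.LeftLinear C] (m : S) where
  /-- The evaluation. -/
  ev (s : S) : F.obj s ⊙ₗ m ⟶ s
  /-- The name of the identity of `m`. -/
  unit : 𝟙_ C ⟶ F.obj m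
  ev_naturality {s s' : S} (f : s ⟶ s') : F.map f ⊵ₗ m ≫ ev s' = ev s ≫ f
  ev_action (c : C) (s : S) :
    (str F c s).hom ⊵ₗ m ≫ ev (c ⊙ₗ s) = (αₗ c (F.obj s) m).hom ≫ c ⊴ₗ ev s
  unit_ev : unit ⊵ₗ m ≫ ev m = (λₗ m).hom
  unit_str_ev (s : S) :
    F.obj s ◁ unit ≫ (str F (F.obj s) m).hom ≫ F.map (ev s) = (ρ_ (F.obj s)).hom

/-- A module functor `F : S ⥤ C` as the left adjoint of `- ⊙ m`: the unit (coevaluation) and the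
value at `𝟙_ C` of the counit of an adjunction `F ⊣ (- ⊙ m)` of module functors. -/
structure InnerCohom (F : S ⥤ C) [F.LeftLinear C] (m : S) where
  /-- The coevaluation. -/
  coev (s : S) : s ⟶ F.obj s ⊙ₗ m
  /-- The counit. -/
  counit : F.obj m ⟶ 𝟙_ C
  coev_naturality {s s' : S} (f : s ⟶ s') : coev s ≫ F.map f ⊵ₗ m = f ≫ coev s'
  coev_action (c : C) (s : S) :
    coev (c ⊙ₗ s) ≫ (str F c s).inv ⊵ₗ m ≫ (αₗ c (F.obj s) m).hom = c ⊴ₗ coev s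
  coev_counit : coev m ≫ counit ⊵ₗ m = (λₗ m).inv
  coev_str_counit (s : S) :
    F.map (coev s) ≫ (str F (F.obj s) m).inv ≫ F.obj s ◁ counit = (ρ_ (F.obj s)).inv

namespace InnerHom

variable {F : S ⥤ C} [F.LeftLinear C] {m : S} (h : InnerHom F m)

lemma ev_action_assoc (c : C) (s : S) {z : S} (g : c ⊙ₗ s ⟶ z) :
    (str F c s).hom ⊵ₗ m ≫ h.ev (c ⊙ₗ s) ≫ g =
      (αₗ c (F.obj s) m).hom ≫ c ⊴ₗ h.ev s ≫ g :=
  (reassoc_of% (h.ev_action c s)) g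

lemma unit_ev_assoc {z : S} (g : m ⟶ z) : h.unit ⊵ₗ m ≫ h.ev m ≫ g = (λₗ m).hom ≫ g :=
  (reassoc_of% h.unit_ev) g

/-- The composition `Hom(m, s) ⊗ G m ⟶ G s` of internal Homs, for a module functor `G`. -/
def comp (G : S ⥤ C) [G.LeftLinear C] (s : S) : F.obj s ⊗ G.obj m ⟶ G.obj s :=
  (str G (F.obj s) m).hom ≫ G.map (h.ev s)

variable (G : S ⥤ C) [G.LeftLinear C]

lemma unit_comp : h.unit ▷ G.obj m ≫ h.comp G m = (λ_ (G.obj m)).hom := by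
  rw [comp, str_naturality_left_assoc, ← G.map_comp, h.unit_ev, str_unit]

lemma unit_comp_assoc {Z : C} (g : G.obj m ⟶ Z) :
    h.unit ▷ G.obj m ≫ h.comp G m ≫ g = (λ_ (G.obj m)).hom ≫ g :=
  (reassoc_of% (h.unit_comp G)) g

lemma comp_unit (s : S) : F.obj s ◁ h.unit ≫ h.comp F s = (ρ_ (F.obj s)).hom :=
  h.unit_str_ev s

lemma comp_naturality {s s' : S} (f : s ⟶ s') :
    F.map f ▷ G.obj m ≫ h.comp G s' = h.comp G s ≫ G.map f := by
  rw [comp, comp, str_naturality_left_assoc, ← G.map_comp, h.ev_naturality, G.map_comp,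
    Category.assoc]

/-- Composition of internal Homs is associative. -/
lemma comp_assoc {n : S} (k : InnerHom G n) (H : S ⥤ C) [H.LeftLinear C] (s : S) :
    h.comp G s ▷ H.obj n ≫ k.comp H s =
      (α_ (F.obj s) (G.obj m) (H.obj n)).hom ≫ F.obj s ◁ k.comp H m ≫ h.comp H s := by
  simp only [comp, comp_whiskerRight, whiskerLeft_comp, Category.assoc]
  rw [str_naturality_left_assoc, str_naturality_left_assoc, ← H.map_comp, ← H.map_comp,
    k.ev_naturality, k.ev_action_assoc, str_naturality_right_assoc]
  simp only [H.map_comp]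
  rw [str_assoc_assoc]

end InnerHom

namespace InnerCohom

variable {F : S ⥤ C} [F.LeftLinear C] {m : S} (h : InnerCohom F m)

lemma coev_naturality_assoc {s s' : S} (f : s ⟶ s') {z : S} (g : F.obj s' ⊙ₗ m ⟶ z) :
    h.coev s ≫ F.map f ⊵ₗ m ≫ g = f ≫ h.coev s' ≫ g :=
  (reassoc_of% (h.coev_naturality f)) g

/-- The morphism `F s ⟶ F s ⊗ F m` given by coevaluation. -/
def cocomp (s : S) : F.obj s ⟶ F.obj s ⊗ F.obj m :=
  F.map (h.coev s) ≫ (str F (F.obj s) m).inv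

lemma cocomp_counit (s : S) :
    h.cocomp s ≫ F.obj s ◁ h.counit = (ρ_ (F.obj s)).inv := by
  rw [cocomp, Category.assoc, h.coev_str_counit]

lemma counit_cocomp : h.cocomp m ≫ h.counit ▷ F.obj m = (λ_ (F.obj m)).inv := by
  rw [cocomp, Category.assoc, ← str_inv_naturality_left, ← F.map_comp_assoc, h.coev_counit,
    str_inv_unit]

lemma cocomp_coassoc (s : S) :
    h.cocomp s ≫ h.cocomp s ▷ F.obj m ≫ (α_ _ _ _).hom =
      h.cocomp s ≫ F.obj s ◁ h.cocomp m := by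
  simp only [cocomp, comp_whiskerRight, whiskerLeft_comp, Category.assoc]
  rw [← str_inv_naturality_left_assoc, ← str_inv_naturality_left_assoc, ← F.map_comp_assoc,
    ← F.map_comp_assoc, str_inv_assoc, Category.assoc, ← F.map_comp_assoc,
    ← str_inv_naturality_right_assoc, ← F.map_comp_assoc]
  congr 2
  rw [h.coev_naturality_assoc, Category.assoc, Category.assoc, h.coev_action]

end InnerCohom

/-- The endomorphism of `s` given by coevaluation and evaluation. -/
def InnerHom.central {F : S ⥤ C} [F.LeftLinear C] {m : S} (h : InnerHom F m) (k : InnerCohom F m)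
    (s : S) : s ⟶ s :=
  k.coev s ≫ h.ev s

variable {F : S ⥤ C} [F.LeftLinear C] {m : S}

/-- The algebra and coalgebra structure of the internal endomorphism object of `m`. -/
def innerEnd (h : InnerHom F m) (k : InnerCohom F m) : FrobeniusData C where
  X := F.obj m
  mul := h.comp F m
  one := h.unit
  comul := k.cocomp m
  counit := k.counit

/-- Coevaluation after evaluation, with the evaluation slid past the coevaluation. -/
lemma InnerHom.coev_ev_assoc (h : InnerHom F m) (k : InnerCohom F m) (s : S) :
    F.map (k.coev s) ⊵ₗ m ≫ (str F (F.obj s) m).inv ⊵ₗ m ≫ (αₗ (F.obj s) (F.obj m) m).hom ≫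
      F.obj s ⊴ₗ h.ev m = h.ev s ≫ k.coev s := by
  rw [← h.ev_action, inv_hom_actionHomLeft_assoc, h.ev_naturality]

/-- Coevaluation is compatible with composition in the right argument: the coproduct of an internal
endomorphism algebra is a morphism of right modules. -/
lemma cocomp_comp_right (h : InnerHom F m) (k : InnerCohom F m) (s : S) :
    k.cocomp s ▷ F.obj m ≫ (α_ _ _ _).hom ≫ F.obj s ◁ h.comp F m =
      h.comp F s ≫ k.cocomp s := by
  simp only [InnerHom.comp, InnerCohom.cocomp, comp_whiskerRight, whiskerLeft_comp, Category.assoc]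
  rw [← cancel_epi (str F (F.obj s) m).inv, Iso.inv_hom_id_assoc,
    ← str_inv_naturality_left_assoc, ← str_inv_naturality_left_assoc, str_inv_assoc_assoc,
    ← whiskerLeft_comp_assoc, Iso.inv_hom_id, whiskerLeft_id, Category.id_comp,
    ← str_inv_naturality_right, ← F.map_comp_assoc, ← F.map_comp_assoc, ← F.map_comp_assoc,
    ← F.map_comp_assoc]
  simp only [Category.assoc]
  rw [h.coev_ev_assoc k]

/-- Coevaluation is compatible with composition in the left argument: the coproduct of an internal
endomorphism algebra is a morphism of left modules. -/
lemma comp_cocomp_left (h : InnerHom F m) (k : InnerCohom F m) (s : S) :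
    F.obj s ◁ k.cocomp m ≫ (α_ _ _ _).inv ≫ h.comp F s ▷ F.obj m =
      h.comp F s ≫ k.cocomp s := by
  simp only [InnerHom.comp, InnerCohom.cocomp, comp_whiskerRight, whiskerLeft_comp, Category.assoc]
  -- Naturality of the coevaluation along `h.ev s`, with `k.coev` computed on `F s ⊙ m`.
  have h₁ : h.ev s ≫ k.coev s = F.obj s ⊴ₗ k.coev m ≫ (αₗ (F.obj s) (F.obj m) m).inv ≫
      (str F (F.obj s) m).hom ⊵ₗ m ≫ F.map (h.ev s) ⊵ₗ m := by
    rw [← k.coev_naturality, ← k.coev_action]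
    simp
  have h₂ : F.obj s ◁ (str F (F.obj m) m).inv ≫ (α_ _ _ _).inv =
      (str F (F.obj s) (F.obj m ⊙ₗ m)).hom ≫ F.map (αₗ (F.obj s) (F.obj m) m).inv ≫
        (str F (F.obj s ⊗ F.obj m) m).inv := by
    rw [← cancel_epi (str F (F.obj s) (F.obj m ⊙ₗ m)).inv, Iso.inv_hom_id_assoc,
      ← cancel_epi (F.map (αₗ (F.obj s) (F.obj m) m).hom), ← F.map_comp_assoc, Iso.hom_inv_id,
      F.map_id, Category.id_comp, ← str_inv_assoc_assoc, Iso.hom_inv_id, Category.comp_id]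
  rw [reassoc_of% h₂, ← F.map_comp_assoc (h.ev s), h₁, str_naturality_right_assoc,
    ← str_inv_naturality_left_assoc, ← str_inv_naturality_left]
  simp only [F.map_comp, Category.assoc]

/-- The internal endomorphism object of `m` is a Frobenius algebra. -/
lemma innerEnd_isFrobenius (h : InnerHom F m) (k : InnerCohom F m) :
    (innerEnd h k).IsFrobenius where
  one_mul := h.unit_comp F
  mul_one := h.comp_unit m
  assoc := h.comp_assoc F h F m
  counit_comul := k.counit_cocomp
  comul_counit := k.cocomp_counit m
  coassoc := k.cocomp_coassoc m
  comul_left := comp_cocomp_left h k m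
  comul_right := cocomp_comp_right h k m

end InnerHom

open MonoidalLeftAction
open Functor.LaxLeftLinear Functor.OplaxLeftLinear Functor.LeftLinear

/-! ### Module adjunctions with a module category and internal Homs -/

section ModuleAdjunctions

variable {C : Type u} [Category.{v} C] [MonoidalCategory C]
  {S : Type u₁} [Category.{v₁} S] [MonoidalLeftAction C S]

/-- A module functor `G : C ⥤ S` is isomorphic to the action on the object `G (𝟙_ C)`. -/
def actIso (G : C ⥤ S) [G.LeftLinear C] (c : C) : c ⊙ₗ G.obj (𝟙_ C) ≅ G.obj c :=
  μₗIso G c (𝟙_ C) ≪≫ G.mapIso (ρ_ c)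

section actIso

variable (G : C ⥤ S) [G.LeftLinear C]

lemma actIso_naturality {c c' : C} (f : c ⟶ c') :
    f ⊵ₗ G.obj (𝟙_ C) ≫ (actIso G c').hom = (actIso G c).hom ≫ G.map f := by
  have h := μₗ_naturality_left G f (𝟙_ C)
  simp only [actIso, Iso.trans_hom, Functor.mapIso_hom, Category.assoc, reassoc_of% h]
  rw [← G.map_comp, ← G.map_comp]
  exact congrArg (fun t => μₗ G c (𝟙_ C) ≫ G.map t) (rightUnitor_naturality f)

lemma actIso_naturality_assoc {c c' : C} (f : c ⟶ c') {z : S} (g : G.obj c' ⟶ z) :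
    f ⊵ₗ G.obj (𝟙_ C) ≫ (actIso G c').hom ≫ g = (actIso G c).hom ≫ G.map f ≫ g :=
  (reassoc_of% (actIso_naturality G f)) g

lemma actIso_inv_naturality {c c' : C} (f : c ⟶ c') :
    G.map f ≫ (actIso G c').inv = (actIso G c).inv ≫ f ⊵ₗ G.obj (𝟙_ C) := by
  rw [Iso.comp_inv_eq, Category.assoc, actIso_naturality, Iso.inv_hom_id_assoc]

lemma actIso_tensor (c d : C) :
    (actIso G (c ⊗ d)).hom =
      (αₗ c d (G.obj (𝟙_ C))).hom ≫ c ⊴ₗ (actIso G d).hom ≫ μₗ G c d := by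
  have h : μₗ G (c ⊗ d) (𝟙_ C) ≫ G.map (α_ c d (𝟙_ C)).hom =
      (αₗ c d (G.obj (𝟙_ C))).hom ≫ c ⊴ₗ μₗ G d (𝟙_ C) ≫ μₗ G c (d ⊗ 𝟙_ C) :=
    μₗ_associativity G c d (𝟙_ C)
  have h' := μₗ_naturality_right G c (ρ_ d).hom
  simp only [actIso, Iso.trans_hom, Functor.mapIso_hom, actionHomRight_comp, Category.assoc]
  rw [h', ← reassoc_of% h, ← G.map_comp]
  congr 2
  exact (rightUnitor_tensor_hom c d)

lemma actIso_tensor_assoc (c d : C) {z : S} (g : G.obj (c ⊗ d) ⟶ z) :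
    (actIso G (c ⊗ d)).hom ≫ g =
      (αₗ c d (G.obj (𝟙_ C))).hom ≫ c ⊴ₗ (actIso G d).hom ≫ μₗ G c d ≫ g := by
  rw [actIso_tensor, Category.assoc, Category.assoc]

lemma actIso_unit : (actIso G (𝟙_ C)).hom = (λₗ (G.obj (𝟙_ C))).hom := by
  rw [μₗ_unitality G (𝟙_ C)]
  simp only [actIso, Iso.trans_hom, Functor.mapIso_hom]
  congr 2
  exact unitors_equal.symm

end actIso

variable [Preadditive C] [Preadditive S] {M : ModuleFunctor C S C} {Mbar : ModuleFunctor C C S}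

/-- A left adjoint `Mbar` of `M` exhibits `M` as the internal Hom functor of `Mbar (𝟙_ C)`. -/
def ModuleAdjunction.innerHom (l : ModuleAdjunction C Mbar M) :
    InnerHom M.functor (Mbar.functor.obj (𝟙_ C)) where
  ev s := (actIso Mbar.functor (M.functor.obj s)).hom ≫ l.counit.app s
  unit := l.unit.app (𝟙_ C)
  ev_naturality f := by
    rw [actIso_naturality_assoc, Category.assoc]
    congr 1
    exact l.counit.naturality f
  ev_action c s := by
    have h : (μₗ Mbar.functor c (M.functor.obj s) ≫ Mbar.functor.map (μₗ M.functor c s)) ≫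
      l.counit.app (c ⊙ₗ s) = c ⊴ₗ l.counit.app s ≫ 𝟙 _ := l.counit_isModuleTransformation c s
    rw [actIso_naturality_assoc, actIso_tensor_assoc, actionHomRight_comp]
    rw [Category.assoc, Category.comp_id] at h
    exact congrArg (fun t => (αₗ _ _ _).hom ≫ c ⊴ₗ (actIso Mbar.functor _).hom ≫ t) h
  unit_ev := by
    rw [actIso_naturality_assoc, actIso_unit]
    simp
  unit_str_ev s := by
    have h : 𝟙 _ ≫ l.unit.app (M.functor.obj s ⊗ 𝟙_ C) = M.functor.obj s ◁ l.unit.app (𝟙_ C) ≫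
        (str M.functor _ _).hom ≫ M.functor.map (μₗ Mbar.functor (M.functor.obj s) (𝟙_ C)) :=
      l.unit_isModuleTransformation (M.functor.obj s) (𝟙_ C)
    rw [Category.id_comp] at h
    simp only [actIso, Iso.trans_hom, Functor.mapIso_hom, Functor.map_comp, Category.assoc]
    have h' := l.unit.naturality (ρ_ (M.functor.obj s)).hom
    dsimp at h'
    rw [← reassoc_of% h, ← reassoc_of% h']
    simp

/-- A right adjoint `Mbar` of `M` is the action on `Mbar (𝟙_ C)`. -/
def ModuleAdjunction.innerCohom (r : ModuleAdjunction C M Mbar) :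
    InnerCohom M.functor (Mbar.functor.obj (𝟙_ C)) where
  coev s := r.unit.app s ≫ (actIso Mbar.functor (M.functor.obj s)).inv
  counit := r.counit.app (𝟙_ C)
  coev_naturality f := by
    rw [Category.assoc, ← actIso_inv_naturality, ← Category.assoc, ← Category.assoc]
    congr 1
    exact (r.unit.naturality f).symm
  coev_action c s := by
    have h : 𝟙 _ ≫ r.unit.app (c ⊙ₗ s) = c ⊴ₗ r.unit.app s ≫
        μₗ Mbar.functor c (M.functor.obj s) ≫ Mbar.functor.map (str M.functor c s).hom :=
      r.unit_isModuleTransformation c s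
    rw [Category.id_comp] at h
    have h' := actIso_inv_naturality Mbar.functor (str M.functor c s).inv
    rw [h, Category.assoc, Category.assoc, Category.assoc, ← reassoc_of% h',
      ← Functor.map_comp_assoc, Iso.hom_inv_id,
      CategoryTheory.Functor.map_id]
    erw [Category.id_comp]
    rw [actionHomRight_comp]
    congr 1
    rw [← cancel_mono (c ⊴ₗ (actIso Mbar.functor (M.functor.obj s)).hom ≫ μₗ Mbar.functor c _),
      Category.assoc, Category.assoc, ← actIso_tensor]
    simp
  coev_counit := by
    rw [Category.assoc, ← actIso_inv_naturality, ← Category.assoc, r.right_triangle_components,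
      Category.id_comp, Iso.inv_eq_inv, actIso_unit]
  coev_str_counit s := by
    have h : (str M.functor _ _).hom ≫ M.functor.map (μₗ Mbar.functor (M.functor.obj s) (𝟙_ C)) ≫
        r.counit.app (M.functor.obj s ⊗ 𝟙_ C) = M.functor.obj s ◁ r.counit.app (𝟙_ C) ≫ 𝟙 _ := by
      have := r.counit_isModuleTransformation (M.functor.obj s) (𝟙_ C)
      exact (Category.assoc _ _ _).symm.trans this
    rw [Category.comp_id] at h
    have h' := r.counit.naturality (ρ_ (M.functor.obj s)).inv
    dsimp at h'
    rw [← h, Iso.inv_hom_id_assoc]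
    simp only [actIso, Iso.trans_inv, Functor.mapIso_inv, Functor.map_comp, Category.assoc]
    rw [← M.functor.map_comp_assoc (δₗ _ _ _), δₗ_comp_μₗ, M.functor.map_id]
    erw [Category.id_comp]
    rw [h', r.left_triangle_components_assoc]

/-- The algebra of a Wilson line is the internal endomorphism object of `Mbar (𝟙_ C)`. -/
lemma wilsonAlgebra_eq (l : ModuleAdjunction C Mbar M) (r : ModuleAdjunction C M Mbar) :
    wilsonAlgebra M Mbar l r = innerEnd l.innerHom r.innerCohom := by
  simp only [wilsonAlgebra, innerEnd, InnerHom.comp, InnerCohom.cocomp,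
    ModuleAdjunction.innerHom, ModuleAdjunction.innerCohom]
  congr 1
  · simp only [actIso, Functor.map_comp, Iso.trans_hom, Functor.mapIso_hom]
    simp only [← Category.assoc]
    rfl
  · simp only [actIso, Functor.map_comp, Iso.trans_inv, Functor.mapIso_inv, Category.assoc]
    rfl

end ModuleAdjunctions

open MonoidalLeftAction
open Functor.LaxLeftLinear Functor.OplaxLeftLinear Functor.LeftLinear

/-! ### Construction of module adjunctions -/

section Construction

variable {C : Type u} [Category.{v} C] [MonoidalCategory C]

section Bijections

variable {D : Type u₁} [Category.{v₁} D] {E : Type u₂} [Category.{v₂} E] {L : D ⥤ E} {R : E ⥤ D}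

/-- The adjunction given by natural bijections `(L X ⟶ Y) → (X ⟶ R Y)`. -/
noncomputable def adjunctionOfBijective (Φ : ∀ X Y, (L.obj X ⟶ Y) → (X ⟶ R.obj Y))
    (hΦ : ∀ X Y, Function.Bijective (Φ X Y))
    (hl : ∀ {X X' Y} (f : X ⟶ X') (g : L.obj X' ⟶ Y), Φ X Y (L.map f ≫ g) = f ≫ Φ X' Y g)
    (hr : ∀ {X Y Y'} (g : L.obj X ⟶ Y) (f : Y ⟶ Y'), Φ X Y' (g ≫ f) = Φ X Y g ≫ R.map f) :
    L ⊣ R :=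
  Adjunction.mkOfHomEquiv
    { homEquiv := fun X Y => Equiv.ofBijective (Φ X Y) (hΦ X Y)
      homEquiv_naturality_left_symm := by
        intro X X' Y f g
        rw [Equiv.symm_apply_eq]
        exact ((hl f _).trans (congrArg (f ≫ ·)
          ((Equiv.ofBijective _ (hΦ _ _)).apply_symm_apply g))).symm
      homEquiv_naturality_right := fun g f => hr g f }

lemma adjunctionOfBijective_unit (Φ : ∀ X Y, (L.obj X ⟶ Y) → (X ⟶ R.obj Y)) (hΦ) (hl) (hr)
    (X : D) : (adjunctionOfBijective Φ hΦ hl hr).unit.app X = Φ X _ (𝟙 _) := by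
  simp [adjunctionOfBijective]

/-- The adjunction given by natural bijections `(X ⟶ R Y) → (L X ⟶ Y)`. -/
noncomputable def adjunctionOfBijective' (Φ : ∀ X Y, (X ⟶ R.obj Y) → (L.obj X ⟶ Y))
    (hΦ : ∀ X Y, Function.Bijective (Φ X Y))
    (hl : ∀ {X X' Y} (f : X ⟶ X') (g : X' ⟶ R.obj Y), Φ X Y (f ≫ g) = L.map f ≫ Φ X' Y g)
    (hr : ∀ {X Y Y'} (g : X ⟶ R.obj Y) (f : Y ⟶ Y'), Φ X Y' (g ≫ R.map f) = Φ X Y g ≫ f) :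
    L ⊣ R :=
  Adjunction.mkOfHomEquiv
    { homEquiv := fun X Y => (Equiv.ofBijective (Φ X Y) (hΦ X Y)).symm
      homEquiv_naturality_left_symm := fun f g => hl f g
      homEquiv_naturality_right := by
        intro X Y Y' g f
        rw [Equiv.symm_apply_eq]
        exact ((hr _ f).trans (congrArg (· ≫ f)
          ((Equiv.ofBijective _ (hΦ _ _)).apply_symm_apply g))).symm }

lemma adjunctionOfBijective'_counit (Φ : ∀ X Y, (X ⟶ R.obj Y) → (L.obj X ⟶ Y)) (hΦ) (hl) (hr)
    (Y : E) : (adjunctionOfBijective' Φ hΦ hl hr).counit.app Y = Φ _ Y (𝟙 _) := by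
  simp [adjunctionOfBijective']

end Bijections

section Doctrinal

variable {D : Type u₁} [Category.{v₁} D] [Preadditive D] [MonoidalLeftAction C D]
  {E : Type u₂} [Category.{v₂} E] [Preadditive E] [MonoidalLeftAction C E]
  {L : ModuleFunctor C D E} {R : ModuleFunctor C E D}

/-- If the unit of an adjunction is a module transformation, then so is the counit. -/
def ModuleAdjunction.ofUnit (adj : L.functor ⊣ R.functor)
    (h : ∀ (c : C) (d : D), adj.unit.app (c ⊙ₗ d) =
      c ⊴ₗ adj.unit.app d ≫ μₗ R.functor c (L.functor.obj d) ≫ R.functor.map (μₗ L.functor c d)) :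
    ModuleAdjunction C L R where
  toAdjunction := adj
  unit_isModuleTransformation c d := (Category.id_comp _).trans (h c d)
  counit_isModuleTransformation c e := by
    refine Eq.trans (Category.assoc _ _ _) (Eq.trans ?_ (Category.comp_id _).symm)
    rw [← cancel_epi (δₗ L.functor c (R.functor.obj e)), δₗ_comp_μₗ_assoc]
    apply (adj.homEquiv _ _).injective
    have h₁ := (adj.homEquiv _ _).apply_symm_apply (μₗ R.functor c e)
    rw [adj.homEquiv_counit, adj.homEquiv_unit] at h₁
    have h₂ := μₗ_naturality_right R.functor c (adj.counit.app e)
    rw [adj.homEquiv_unit, adj.homEquiv_unit]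
    refine h₁.trans ?_
    rw [h, R.functor.map_comp, Category.assoc, Category.assoc,
      ← R.functor.map_comp_assoc (μₗ _ _ _), μₗ_comp_δₗ, CategoryTheory.Functor.map_id,
      Category.id_comp]
    refine Eq.trans ?_ (congrArg (fun t => c ⊴ₗ adj.unit.app (R.functor.obj e) ≫ t) h₂)
    rw [← actionHomRight_comp_assoc, adj.right_triangle_components]
    exact (by simp : μₗ R.functor c e = c ⊴ₗ 𝟙 (R.functor.obj e) ≫ μₗ R.functor c e)

/-- If the counit of an adjunction is a module transformation, then so is the unit. -/
def ModuleAdjunction.ofCounit (adj : L.functor ⊣ R.functor)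
    (h : ∀ (c : C) (e : E), μₗ L.functor c (R.functor.obj e) ≫ L.functor.map (μₗ R.functor c e) ≫
      adj.counit.app (c ⊙ₗ e) = c ⊴ₗ adj.counit.app e) :
    ModuleAdjunction C L R where
  toAdjunction := adj
  counit_isModuleTransformation c e :=
    (Category.assoc _ _ _).trans ((h c e).trans (Category.comp_id _).symm)
  unit_isModuleTransformation c d := by
    refine Eq.trans (Category.id_comp _) ?_
    change _ = c ⊴ₗ adj.unit.app d ≫ μₗ R.functor c (L.functor.obj d) ≫
      R.functor.map (μₗ L.functor c d)
    apply (adj.homEquiv _ _).symm.injective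
    rw [adj.homEquiv_counit, adj.homEquiv_counit]
    refine (adj.left_triangle_components _).trans ?_
    have h₁ : L.functor.map (R.functor.map (μₗ L.functor c d)) ≫
        adj.counit.app (L.functor.obj (c ⊙ₗ d)) =
          adj.counit.app (c ⊙ₗ L.functor.obj d) ≫ μₗ L.functor c d := adj.counit_naturality _
    have h₂ : c ⊴ₗ L.functor.map (adj.unit.app d) ≫
        μₗ L.functor c (R.functor.obj (L.functor.obj d)) =
          μₗ L.functor c d ≫ L.functor.map (c ⊴ₗ adj.unit.app d) :=
      μₗ_naturality_right L.functor c (adj.unit.app d)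
    rw [← cancel_epi (μₗ L.functor c d), L.functor.map_comp, L.functor.map_comp, Category.assoc,
      Category.assoc, h₁, ← reassoc_of% h₂, reassoc_of% (h c (L.functor.obj d)),
      ← actionHomRight_comp_assoc, adj.left_triangle_components, actionHomRight_id,
      Category.id_comp]
    exact Category.comp_id _

end Doctrinal

variable {S : Type u₁} [Category.{v₁} S] [MonoidalLeftAction C S]

lemma associator_inv_actionHomLeft (c₁ c₂ c₃ : C) (s : S) :
    (α_ c₁ c₂ c₃).inv ⊵ₗ s = (αₗ c₁ (c₂ ⊗ c₃) s).hom ≫ c₁ ⊴ₗ (αₗ c₂ c₃ s).hom ≫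
      (αₗ c₁ c₂ (c₃ ⊙ₗ s)).inv ≫ (αₗ (c₁ ⊗ c₂) c₃ s).inv := by
  rw [← cancel_epi ((α_ c₁ c₂ c₃).hom ⊵ₗ s), hom_inv_actionHomLeft, associator_actionHom_assoc]
  simp

/-- The action on `X` of the zigzag identity for `Y'`. -/
lemma act_coevaluation_evaluation (X : S) (Y Y' : C) [ExactPairing Y Y'] :
    Y' ⊴ₗ ((λₗ[C] X).inv ≫ η_ Y Y' ⊵ₗ X ≫ (αₗ Y Y' X).hom) ≫
      (αₗ Y' Y (Y' ⊙ₗ X)).inv ≫ ε_ Y Y' ⊵ₗ (Y' ⊙ₗ X) ≫ (λₗ[C] (Y' ⊙ₗ X)).hom = 𝟙 _ := by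
  have h : (Y' ◁ η_ Y Y' ≫ (α_ _ _ _).inv ≫ ε_ Y Y' ▷ Y') ⊵ₗ X =
      ((ρ_ Y').hom ≫ (λ_ Y').inv) ⊵ₗ X := by
    rw [ExactPairing.coevaluation_evaluation]
  have h' : (λ_ Y').inv ⊵ₗ X = (λₗ[C] _).inv ≫ (αₗ (𝟙_ C) Y' X).inv := by
    rw [← cancel_epi ((λ_ Y').hom ⊵ₗ X), hom_inv_actionHomLeft, leftUnitor_actionHom]
    simp
  rw [comp_actionHomLeft, comp_actionHomLeft, whiskerLeft_actionHomLeft,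
    associator_inv_actionHomLeft, whiskerRight_actionHomLeft, comp_actionHomLeft,
    rightUnitor_actionHom, h'] at h
  simp only [Category.assoc, Iso.inv_hom_id_assoc, Iso.cancel_iso_hom_left] at h
  simp only [actionHomRight_comp, Category.assoc]
  rw [← cancel_epi (Y' ⊴ₗ (λₗ[C] X).hom), actionHomRight_hom_inv_assoc,
    ← cancel_mono ((λₗ[C] (Y' ⊙ₗ X)).inv ≫ (αₗ (𝟙_ C) Y' X).inv)]
  simpa only [Category.assoc, Category.comp_id, Iso.hom_inv_id_assoc] using h

/-- The action on `X` of the zigzag identity for `Y`. -/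
lemma act_evaluation_coevaluation (X : S) (Y Y' : C) [ExactPairing Y Y'] :
    (λₗ[C] (Y ⊙ₗ X)).inv ≫ η_ Y Y' ⊵ₗ (Y ⊙ₗ X) ≫ (αₗ Y Y' (Y ⊙ₗ X)).hom ≫
      Y ⊴ₗ ((αₗ Y' Y X).inv ≫ ε_ Y Y' ⊵ₗ X ≫ (λₗ[C] X).hom) = 𝟙 _ := by
  have h : (η_ Y Y' ▷ Y ≫ (α_ _ _ _).hom ≫ Y ◁ ε_ Y Y') ⊵ₗ X =
      ((λ_ Y).hom ≫ (ρ_ Y).inv) ⊵ₗ X := by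
    rw [ExactPairing.evaluation_coevaluation]
  have h' : (ρ_ Y).inv ⊵ₗ X = Y ⊴ₗ (λₗ[C] _).inv ≫ (αₗ Y (𝟙_ C) X).inv := by
    rw [← cancel_epi ((ρ_ Y).hom ⊵ₗ X), hom_inv_actionHomLeft, rightUnitor_actionHom]
    simp
  have h'' : (α_ Y Y' Y).hom ⊵ₗ X = (αₗ (Y ⊗ Y') Y X).hom ≫ (αₗ Y Y' (Y ⊙ₗ X)).hom ≫
      Y ⊴ₗ (αₗ Y' Y X).inv ≫ (αₗ Y (Y' ⊗ Y) X).inv := by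
    rw [← associator_actionHom_assoc]
    simp
  rw [comp_actionHomLeft, comp_actionHomLeft, whiskerLeft_actionHomLeft, h'',
    whiskerRight_actionHomLeft, comp_actionHomLeft, leftUnitor_actionHom, h'] at h
  simp only [Category.assoc, Iso.inv_hom_id_assoc, Iso.cancel_iso_hom_left] at h
  simp only [actionHomRight_comp]
  rw [← cancel_epi (λₗ[C] (Y ⊙ₗ X)).hom, Iso.hom_inv_id_assoc,
    ← cancel_mono (Y ⊴ₗ (λₗ[C] X).inv ≫ (αₗ Y (𝟙_ C) X).inv)]
  simpa only [Category.assoc, Category.comp_id, actionHomRight_hom_inv_assoc] using h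

/-- Transposition along an exact pairing, for a module category. -/
def actHomEquiv (X : S) (Y Y' : C) (Z : S) [ExactPairing Y Y'] :
    (Y' ⊙ₗ X ⟶ Z) ≃ (X ⟶ Y ⊙ₗ Z) where
  toFun f := (λₗ[C] X).inv ≫ η_ Y Y' ⊵ₗ X ≫ (αₗ Y Y' X).hom ≫ Y ⊴ₗ f
  invFun f := Y' ⊴ₗ f ≫ (αₗ Y' Y Z).inv ≫ ε_ Y Y' ⊵ₗ Z ≫ (λₗ[C] Z).hom
  left_inv f := by
    have h := act_coevaluation_evaluation X Y Y' =≫ f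
    simp only [actionHomRight_comp, Category.assoc, Category.id_comp] at h ⊢
    refine Eq.trans ?_ h
    congr 3
    rw [actionUnitIso_hom_naturality, ← action_exchange_assoc, tensor_actionHomRight]
    simp only [Category.assoc, Iso.inv_hom_id_assoc]
  right_inv f := by
    have h := f ≫= act_evaluation_coevaluation Z Y Y'
    simp only [actionHomRight_comp, Category.comp_id] at h ⊢
    refine Eq.trans ?_ h
    rw [← actionUnitIso_inv_naturality_assoc, action_exchange_assoc, tensor_actionHomRight]
    simp only [Category.assoc, Iso.inv_hom_id_assoc]

/-- Module functors are compatible with transposition. -/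
lemma map_actHomEquiv {S' : Type u₂} [Category.{v₂} S'] [MonoidalLeftAction C S'] (F : S ⥤ S')
    [F.LeftLinear C] {X : S} {Y Y' : C} {Z : S} [ExactPairing Y Y'] (f : Y' ⊙ₗ X ⟶ Z) :
    F.map (actHomEquiv X Y Y' Z f) =
      actHomEquiv (F.obj X) Y Y' (F.obj Z) (μₗ F Y' X ≫ F.map f) ≫ μₗ F Y Z := by
  simp only [actHomEquiv, Equiv.coe_fn_mk, F.map_comp, Category.assoc, actionHomRight_comp]
  rw [μₗ_naturality_right, ← μₗ_associativity_assoc, μₗ_naturality_left_assoc,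
    μₗ_unitality_inv_assoc]

/-- The preceding compatibility for a functor to `C`, with the tensor product of `C` in place of
the action of `C` on itself. -/
lemma map_actHomEquiv' (F : S ⥤ C) [F.LeftLinear C] {X : S} {Y Y' : C} {Z : S} [ExactPairing Y Y']
    (f : Y' ⊙ₗ X ⟶ Z) :
    F.map (actHomEquiv X Y Y' Z f) =
      tensorLeftHomEquiv (F.obj X) Y Y' (F.obj Z) ((str F Y' X).hom ≫ F.map f) ≫
        (str F Y Z).hom :=
  map_actHomEquiv F f

lemma actHomEquiv_comp {X : S} {Y Y' : C} {Z Z' : S} [ExactPairing Y Y'] (f : Y' ⊙ₗ X ⟶ Z)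
    (g : Z ⟶ Z') : actHomEquiv X Y Y' Z f ≫ Y ⊴ₗ g = actHomEquiv X Y Y' Z' (f ≫ g) := by
  simp [actHomEquiv]

lemma tensorLeftHomEquiv_comp {X Y Y' Z Z' : C} [ExactPairing Y Y'] (f : Y' ⊗ X ⟶ Z) (g : Z ⟶ Z') :
    tensorLeftHomEquiv X Y Y' Z f ≫ Y ◁ g = tensorLeftHomEquiv X Y Y' Z' (f ≫ g) := by
  simp [tensorLeftHomEquiv]

lemma comp_tensorLeftHomEquiv {X X' Y Y' Z : C} [ExactPairing Y Y'] (f : Y' ⊗ X ⟶ Z)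
    (g : X' ⟶ X) :
    g ≫ tensorLeftHomEquiv X Y Y' Z f = tensorLeftHomEquiv X' Y Y' Z (Y' ◁ g ≫ f) := by
  simp only [tensorLeftHomEquiv, Equiv.coe_fn_mk, whiskerLeft_comp]
  rw [leftUnitor_inv_naturality_assoc, whisker_exchange_assoc]
  simp

section ActOn

variable (C)

/-- The action on an object `m` of `S`, as a functor `C ⥤ S`. -/
def actOn (m : S) : C ⥤ S where
  obj c := c ⊙ₗ m
  map f := f ⊵ₗ m

instance actOnLeftLinear (m : S) : (actOn C m).LeftLinear C where
  μₗ c d := (αₗ c d m).inv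
  δₗ c d := (αₗ c d m).hom
  μₗ_naturality_left f d := (by simp :
    f ⊵ₗ (d ⊙ₗ m) ≫ (αₗ _ d m).inv = (αₗ _ d m).inv ≫ (f ▷ d) ⊵ₗ m)
  μₗ_naturality_right c d d' f := (by simp :
    c ⊴ₗ f ⊵ₗ m ≫ (αₗ c d' m).inv = (αₗ c d m).inv ≫ (c ◁ f) ⊵ₗ m)
  μₗ_associativity c c' d := by
    change (αₗ (c ⊗ c') d m).inv ≫ (α_ c c' d).hom ⊵ₗ m =
      (αₗ c c' (d ⊙ₗ m)).hom ≫ c ⊴ₗ (αₗ c' d m).inv ≫ (αₗ c (c' ⊗ d) m).inv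
    rw [Iso.inv_comp_eq, ← associator_actionHom_assoc]
    simp
  μₗ_unitality d := (by simp :
    (λₗ[C] (d ⊙ₗ m)).hom = (αₗ (𝟙_ C) d m).inv ≫ (λ_ d).hom ⊵ₗ m)
  δₗ_naturality_left f d := (by simp :
    (f ▷ d) ⊵ₗ m ≫ (αₗ _ d m).hom = (αₗ _ d m).hom ≫ f ⊵ₗ (d ⊙ₗ m))
  δₗ_naturality_right c d d' f := (by simp :
    (c ◁ f) ⊵ₗ m ≫ (αₗ c d' m).hom = (αₗ c d m).hom ≫ c ⊴ₗ f ⊵ₗ m)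
  δₗ_associativity c c' d := (associator_actionHom c c' d m).symm
  δₗ_unitality_inv d := by
    change (λₗ[C] (d ⊙ₗ m)).inv = (λ_ d).inv ⊵ₗ m ≫ (αₗ (𝟙_ C) d m).hom
    rw [← cancel_epi ((λ_ d).hom ⊵ₗ m), hom_inv_actionHomLeft_assoc, leftUnitor_actionHom,
      Category.assoc, Iso.hom_inv_id, Category.comp_id]
  μₗ_comp_δₗ c d := (αₗ c d m).inv_hom_id
  δₗ_comp_μₗ c d := (αₗ c d m).hom_inv_id

end ActOn

section LeftAdjoint

variable (F : S ⥤ C) [F.LeftLinear C] {m : S} (u : 𝟙_ C ⟶ F.obj m)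

/-- The morphism `c ⟶ F s` corresponding to `c ⊙ m ⟶ s` under a morphism `u : 𝟙_ C ⟶ F m`. -/
def toHom (c : C) (s : S) (f : c ⊙ₗ m ⟶ s) : c ⟶ F.obj s :=
  (ρ_ c).inv ≫ c ◁ u ≫ (str F c m).hom ≫ F.map f

lemma toHom_naturality_left {c c' : C} {s : S} (f : c ⟶ c') (g : c' ⊙ₗ m ⟶ s) :
    toHom F u c s (f ⊵ₗ m ≫ g) = f ≫ toHom F u c' s g := by
  simp only [toHom, F.map_comp]
  rw [← str_naturality_left_assoc, whisker_exchange_assoc, rightUnitor_inv_naturality_assoc]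

lemma toHom_naturality_right {c : C} {s s' : S} (g : c ⊙ₗ m ⟶ s) (f : s ⟶ s') :
    toHom F u c s' (g ≫ f) = toHom F u c s g ≫ F.map f := by
  simp [toHom]

/-- If `u : 𝟙_ C ⟶ F m` is universal, then so are the morphisms `c ⟶ F (c ⊙ m)` obtained from it:
the case of general `c` is reduced to that of the tensor unit by means of the dual of `c`. -/
lemma toHom_bijective [RigidCategory C]
    (hu : ∀ s, Function.Bijective fun f : m ⟶ s => u ≫ F.map f) (c : C) (s : S) :
    Function.Bijective (toHom F u c s) := by
  have key : ∀ f : c ⊙ₗ m ⟶ s, u ≫ F.map (actHomEquiv m (ᘁc) c s f) =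
      tensorLeftHomEquiv (𝟙_ C) (ᘁc) c (F.obj s) ((ρ_ c).hom ≫ toHom F u c s f) ≫
        (str F (ᘁc) s).hom := by
    intro f
    rw [map_actHomEquiv', ← Category.assoc, comp_tensorLeftHomEquiv]
    simp [toHom]
  constructor
  · intro f g h
    exact (actHomEquiv m (ᘁc) c s).injective ((hu _).1 (by simp only [key, h]))
  · intro y
    obtain ⟨g, hg⟩ := (hu _).2 (tensorLeftHomEquiv (𝟙_ C) (ᘁc) c (F.obj s) ((ρ_ c).hom ≫ y) ≫
      (str F (ᘁc) s).hom)
    refine ⟨(actHomEquiv m (ᘁc) c s).symm g, ?_⟩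
    have h := key ((actHomEquiv m (ᘁc) c s).symm g)
    rw [Equiv.apply_symm_apply] at h
    have h' := h.symm.trans hg
    rw [cancel_mono, EmbeddingLike.apply_eq_iff_eq, cancel_epi] at h'
    exact h'

end LeftAdjoint

section RightAdjoint

variable (F : S ⥤ C) [F.LeftLinear C] {m : S} (e : F.obj m ⟶ 𝟙_ C)

/-- The morphism `F s ⟶ c` corresponding to `s ⟶ c ⊙ m` under a morphism `e : F m ⟶ 𝟙_ C`. -/
def ofHom (s : S) (c : C) (f : s ⟶ c ⊙ₗ m) : F.obj s ⟶ c :=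
  F.map f ≫ (str F c m).inv ≫ c ◁ e ≫ (ρ_ c).hom

/-- If `e : F m ⟶ 𝟙_ C` is universal, then so are the morphisms `F (c ⊙ m) ⟶ c` obtained from it:
the case of general `c` is reduced to that of the tensor unit by means of the dual of `c`. -/
lemma ofHom_bijective [RigidCategory C]
    (he : ∀ s, Function.Bijective fun f : s ⟶ m => F.map f ≫ e) (s : S) (c : C) :
    Function.Bijective (ofHom F e s c) := by
  have key : ∀ f : cᘁ ⊙ₗ s ⟶ m, ofHom F e s c (actHomEquiv s c cᘁ m f) =
      tensorLeftHomEquiv (F.obj s) c cᘁ (𝟙_ C) ((str F cᘁ s).hom ≫ F.map f ≫ e) ≫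
        (ρ_ c).hom := by
    intro f
    rw [ofHom, map_actHomEquiv', Category.assoc, Iso.hom_inv_id_assoc, ← Category.assoc,
      tensorLeftHomEquiv_comp, Category.assoc]
  rw [← (actHomEquiv s c cᘁ m).bijective.of_comp_iff]
  have : ofHom F e s c ∘ actHomEquiv s c cᘁ m =
      ((Iso.homCongr (Iso.refl _) (ρ_ c)) ∘ tensorLeftHomEquiv (F.obj s) c cᘁ (𝟙_ C) ∘
        (Iso.homCongr (str F cᘁ s).symm (Iso.refl _))) ∘ fun f => F.map f ≫ e := by
    funext f
    simp [key]
  rw [this]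
  exact ((Equiv.bijective _).comp ((Equiv.bijective _).comp (Equiv.bijective _))).comp (he _)

end RightAdjoint

section

variable [Preadditive C] [Preadditive S]

/-- An object `m` of `S` whose action `c ↦ c ⊙ m` is additive, as a module functor. -/
def actOnModule (m : S) (hm : (actOn C m).Additive) : ModuleFunctor C C S where
  functor := actOn C m
  additive := hm
  leftLinear := inferInstance

/-- A universal morphism `𝟙_ C ⟶ M m` makes the action on `m` a left adjoint of `M`. -/
noncomputable def leftAdjointOfUniversal [RigidCategory C] (M : ModuleFunctor C S C) {m : S}
    (hm : (actOn C m).Additive) (u : 𝟙_ C ⟶ M.functor.obj m)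
    (hu : ∀ s, Function.Bijective fun f : m ⟶ s => u ≫ M.functor.map f) :
    ModuleAdjunction C (actOnModule m hm) M :=
  ModuleAdjunction.ofUnit
    (adjunctionOfBijective (toHom M.functor u) (toHom_bijective M.functor u hu)
      (toHom_naturality_left M.functor u) (toHom_naturality_right M.functor u))
    (by
      -- The unit at `c` is `c` tensored with the universal morphism, which is compatible with the
      -- action by coherence of the structure isomorphisms.
      intro c d
      have h (c : C) : (adjunctionOfBijective (L := (actOnModule m hm).functor) (toHom M.functor u)
          (toHom_bijective M.functor u hu) (toHom_naturality_left M.functor u)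
          (toHom_naturality_right M.functor u)).unit.app c =
            toHom M.functor u c _ (𝟙 (c ⊙ₗ m)) :=
        adjunctionOfBijective_unit (L := (actOnModule m hm).functor) _ _ _ _ c
      refine (h _).trans (Eq.trans ?_ (congrArg (c ⊴ₗ · ≫ μₗ M.functor c _ ≫ _) (h d)).symm)
      change toHom M.functor u (c ⊗ d) _ (𝟙 ((c ⊗ d) ⊙ₗ m)) =
        c ◁ toHom M.functor u d _ (𝟙 (d ⊙ₗ m)) ≫ (str M.functor c (d ⊙ₗ m)).hom ≫
          M.functor.map (αₗ c d m).inv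
      simp only [toHom, CategoryTheory.Functor.map_id, Category.comp_id, whiskerLeft_comp,
        Category.assoc]
      rw [← cancel_mono (M.functor.map (αₗ c d m).hom)]
      simp only [Category.assoc]
      rw [str_assoc, ← M.functor.map_comp, Iso.inv_hom_id]
      simp)

/-- A universal morphism `e : M m ⟶ 𝟙_ C` makes a module functor `Mbar` with `Mbar (𝟙_ C) = m` a
right adjoint of `M`. -/
lemma exists_rightAdjoint_of_universal [RigidCategory C] (M : ModuleFunctor C S C)
    (Mbar : ModuleFunctor C C S) (e : M.functor.obj (Mbar.functor.obj (𝟙_ C)) ⟶ 𝟙_ C)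
    (he : ∀ s, Function.Bijective fun f : s ⟶ Mbar.functor.obj (𝟙_ C) => M.functor.map f ≫ e) :
    ∃ r : ModuleAdjunction C M Mbar, r.counit.app (𝟙_ C) = e := by
  -- The transposition to be: identify `Mbar c` with `c ⊙ m`, apply `M`, and then `c ⊗ e`.
  let Ψ (s : S) (c : C) (f : s ⟶ Mbar.functor.obj c) : M.functor.obj s ⟶ c :=
    ofHom M.functor e s c (f ≫ (actIso Mbar.functor c).inv)
  have hΨ (s : S) (c : C) : Function.Bijective (Ψ s c) := by
    refine (ofHom_bijective M.functor e he s c).comp (g := fun f => ofHom M.functor e s c f)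
      (f := fun f => f ≫ (actIso Mbar.functor c).inv) ⟨fun f g h => ?_, fun f => ?_⟩
    · exact (cancel_mono _).1 h
    · exact ⟨f ≫ (actIso Mbar.functor c).hom, by simp⟩
  have hl {s s' : S} {c : C} (f : s ⟶ s') (g : s' ⟶ Mbar.functor.obj c) :
      Ψ s c (f ≫ g) = M.functor.map f ≫ Ψ s' c g := by
    simp [Ψ, ofHom]
  have hr {s : S} {c c' : C} (g : s ⟶ Mbar.functor.obj c) (f : c ⟶ c') :
      Ψ s c' (g ≫ Mbar.functor.map f) = Ψ s c g ≫ f := by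
    simp only [Ψ, ofHom, Category.assoc, actIso_inv_naturality]
    simp only [M.functor.map_comp, Category.assoc]
    rw [str_inv_naturality_left_assoc, ← whisker_exchange_assoc, rightUnitor_naturality]
  refine ⟨ModuleAdjunction.ofCounit (adjunctionOfBijective' Ψ hΨ hl hr) ?_, ?_⟩
  · intro c d
    rw [adjunctionOfBijective'_counit, adjunctionOfBijective'_counit]
    have h : μₗ Mbar.functor c d ≫ (actIso Mbar.functor (c ⊗ d)).inv =
        c ⊴ₗ (actIso Mbar.functor d).inv ≫ (αₗ c d _).inv := by
      rw [Iso.comp_inv_eq, Category.assoc, actIso_tensor]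
      simp
    have h' : (str M.functor c (d ⊙ₗ _)).hom ≫
        M.functor.map (αₗ c d (Mbar.functor.obj (𝟙_ C))).inv ≫ (str M.functor (c ⊗ d) _).inv =
          c ◁ (str M.functor d _).inv ≫ (α_ _ _ _).inv := by
      rw [← cancel_mono (α_ _ _ _).hom, Category.assoc, Category.assoc, str_inv_assoc,
        ← M.functor.map_comp_assoc, Iso.inv_hom_id]
      simp
    have e₁ : M.functor.map (μₗ Mbar.functor c d) ≫ Ψ _ (c ⊗ d) (𝟙 _) =
        ofHom M.functor e _ (c ⊗ d) (μₗ Mbar.functor c d ≫ (actIso Mbar.functor (c ⊗ d)).inv) := by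
      simp [Ψ, ofHom]
    refine (congrArg ((str M.functor c (Mbar.functor.obj d)).hom ≫ ·) e₁).trans ?_
    change _ = c ◁ Ψ _ d (𝟙 _)
    rw [h]
    simp only [Ψ, ofHom, M.functor.map_comp, Category.assoc, CategoryTheory.Functor.map_id,
      Category.id_comp, whiskerLeft_comp]
    rw [← str_naturality_right_assoc, reassoc_of% h']
    simp
  · refine (adjunctionOfBijective'_counit Ψ hΨ hl hr (𝟙_ C)).trans ?_
    have h : M.functor.map (actIso Mbar.functor (𝟙_ C)).inv ≫
        (str M.functor (𝟙_ C) (Mbar.functor.obj (𝟙_ C))).inv = (λ_ _).inv := by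
      rw [← str_inv_unit]
      congr 2
      rw [Iso.inv_eq_inv, actIso_unit]
    simp only [Ψ, ofHom, M.functor.map_comp, Category.assoc, CategoryTheory.Functor.map_id,
      Category.id_comp]
    rw [reassoc_of% h]
    simp [← unitors_equal]

end

section DoctrinalRight

variable {D : Type u₁} [Category.{v₁} D] [MonoidalLeftAction C D]
  {E : Type u₂} [Category.{v₂} E] [MonoidalLeftAction C E]
  {L : D ⥤ E} [L.LeftLinear C] {R : E ⥤ D} (adj : L ⊣ R)

/-- The counit of an adjunction, with codomain `e` in place of the value of the identity
functor. -/
def counitAt (e : E) : L.obj (R.obj e) ⟶ e := adj.counit.app e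

lemma counitAt_naturality {e e' : E} (f : e ⟶ e') :
    L.map (R.map f) ≫ counitAt adj e' = counitAt adj e ≫ f :=
  adj.counit.naturality f

lemma homEquiv_symm_eq {X : D} {Y : E} (f : X ⟶ R.obj Y) :
    (adj.homEquiv X Y).symm f = L.map f ≫ counitAt adj Y :=
  adj.homEquiv_counit X Y f

lemma adj_ext {X : D} {Y : E} {f g : X ⟶ R.obj Y}
    (h : L.map f ≫ counitAt adj Y = L.map g ≫ counitAt adj Y) : f = g := by
  rw [← homEquiv_symm_eq, ← homEquiv_symm_eq] at h
  exact (adj.homEquiv _ _).symm.injective h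

/-- The lax structure of a right adjoint of a module functor. -/
def rightAdjointμ (c : C) (e : E) : c ⊙ₗ R.obj e ⟶ R.obj (c ⊙ₗ e) :=
  adj.homEquiv _ _ (δₗ L c (R.obj e) ≫ c ⊴ₗ counitAt adj e)

lemma map_rightAdjointμ (c : C) (e : E) :
    L.map (rightAdjointμ adj c e) ≫ counitAt adj (c ⊙ₗ e) =
      δₗ L c (R.obj e) ≫ c ⊴ₗ counitAt adj e := by
  rw [← homEquiv_symm_eq, rightAdjointμ, Equiv.symm_apply_apply]

lemma map_rightAdjointμ_assoc (c : C) (e : E) {z : E} (g : c ⊙ₗ e ⟶ z) :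
    L.map (rightAdjointμ adj c e) ≫ counitAt adj (c ⊙ₗ e) ≫ g =
      δₗ L c (R.obj e) ≫ c ⊴ₗ counitAt adj e ≫ g :=
  (reassoc_of% (map_rightAdjointμ adj c e)) g

lemma rightAdjointμ_naturality_left {c c' : C} (f : c ⟶ c') (e : E) :
    f ⊵ₗ R.obj e ≫ rightAdjointμ adj c' e = rightAdjointμ adj c e ≫ R.map (f ⊵ₗ e) := by
  apply adj_ext adj
  simp only [L.map_comp, Category.assoc, counitAt_naturality]
  rw [map_rightAdjointμ, map_rightAdjointμ_assoc, δₗ_naturality_left_assoc, action_exchange]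

lemma rightAdjointμ_naturality_right (c : C) {e e' : E} (f : e ⟶ e') :
    c ⊴ₗ R.map f ≫ rightAdjointμ adj c e' = rightAdjointμ adj c e ≫ R.map (c ⊴ₗ f) := by
  apply adj_ext adj
  simp only [L.map_comp, Category.assoc, counitAt_naturality]
  rw [map_rightAdjointμ, map_rightAdjointμ_assoc, δₗ_naturality_right_assoc,
    ← actionHomRight_comp, ← actionHomRight_comp, counitAt_naturality]

lemma rightAdjointμ_associativity (c c' : C) (e : E) :
    rightAdjointμ adj (c ⊗ c') e ≫ R.map (αₗ c c' e).hom =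
      (αₗ c c' (R.obj e)).hom ≫ c ⊴ₗ rightAdjointμ adj c' e ≫
        rightAdjointμ adj c (c' ⊙ₗ e) := by
  apply adj_ext adj
  simp only [L.map_comp, Category.assoc, counitAt_naturality]
  rw [map_rightAdjointμ_assoc, map_rightAdjointμ,
    δₗ_naturality_right_assoc, ← actionHomRight_comp, map_rightAdjointμ, tensor_actionHomRight]
  simp only [Category.assoc, Iso.inv_hom_id, Category.comp_id, actionHomRight_comp]
  exact δₗ_associativity_assoc L c c' (R.obj e) _

lemma rightAdjointμ_unitality (e : E) :
    (λₗ[C] (R.obj e)).hom = rightAdjointμ adj (𝟙_ C) e ≫ R.map (λₗ e).hom := by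
  apply adj_ext adj
  simp only [L.map_comp, Category.assoc, counitAt_naturality]
  rw [map_rightAdjointμ_assoc, ← actionUnitIso_hom_naturality]
  exact (δₗ_unitality_hom_assoc L (R.obj e) _).symm

/-- Over a rigid category the lax structure of the right adjoint is invertible: composition with
it corresponds, through the adjunction and transposition along `c`, to the structure isomorphism
of `L` at `cᘁ`. -/
instance isIso_rightAdjointμ [RigidCategory C] (c : C) (e : E) :
    IsIso (rightAdjointμ adj c e) := by
  have key (x : D) : Function.Bijective fun f : x ⟶ c ⊙ₗ R.obj e => f ≫ rightAdjointμ adj c e := by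
    rw [← (actHomEquiv x c cᘁ (R.obj e)).bijective.of_comp_iff]
    rw [← ((adj.homEquiv x (c ⊙ₗ e)).symm.bijective).of_comp_iff']
    have h : (adj.homEquiv x (c ⊙ₗ e)).symm ∘ ((fun f => f ≫ rightAdjointμ adj c e) ∘
        actHomEquiv x c cᘁ (R.obj e)) = actHomEquiv (L.obj x) c cᘁ e ∘
          (Iso.homCongr (μₗIso L cᘁ x).symm (Iso.refl e)) ∘ (adj.homEquiv (cᘁ ⊙ₗ x) e).symm := by
      funext g
      simp only [Function.comp_apply, homEquiv_symm_eq, L.map_comp, Category.assoc,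
        map_rightAdjointμ, map_actHomEquiv, μₗ_comp_δₗ_assoc]
      rw [actHomEquiv_comp]
      simp
    rw [h]
    exact (Equiv.bijective _).comp ((Equiv.bijective _).comp (Equiv.bijective _))
  obtain ⟨g, hg⟩ := (key _).2 (𝟙 _)
  refine ⟨g, (key _).1 ?_, hg⟩
  simp only at hg ⊢
  rw [Category.assoc, hg, Category.comp_id, Category.id_comp]

/-- A right adjoint of a module functor over a rigid category is a module functor. -/
@[reducible]
noncomputable def rightAdjointLeftLinear [RigidCategory C] : R.LeftLinear C where
  μₗ := rightAdjointμ adj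
  δₗ c e := inv (rightAdjointμ adj c e)
  μₗ_naturality_left := rightAdjointμ_naturality_left adj
  μₗ_naturality_right := rightAdjointμ_naturality_right adj
  μₗ_associativity := rightAdjointμ_associativity adj
  μₗ_unitality := rightAdjointμ_unitality adj
  δₗ_naturality_left f e := by
    rw [IsIso.comp_inv_eq, Category.assoc, rightAdjointμ_naturality_left, IsIso.inv_hom_id_assoc]
  δₗ_naturality_right c _ _ f := by
    rw [IsIso.comp_inv_eq, Category.assoc, rightAdjointμ_naturality_right, IsIso.inv_hom_id_assoc]
  δₗ_associativity c c' e := by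
    rw [IsIso.inv_comp_eq, ← cancel_mono (c ⊴ₗ rightAdjointμ adj c' e ≫
      rightAdjointμ adj c (c' ⊙ₗ e)), ← rightAdjointμ_associativity]
    simp
  δₗ_unitality_inv e := by
    rw [IsIso.eq_comp_inv, Iso.inv_comp_eq, rightAdjointμ_unitality adj, Category.assoc,
      ← R.map_comp, Iso.hom_inv_id, R.map_id, Category.comp_id]
  μₗ_comp_δₗ c e := IsIso.hom_inv_id _
  δₗ_comp_μₗ c e := IsIso.inv_hom_id _

end DoctrinalRight

end Construction

/-! ### Finitely semisimple categories -/

section Semisimple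

variable {D : Type u} [Category.{v} D]

section Abelian

variable [Abelian D]

/-- In a semisimple category every morphism `f` has a generalized inverse. -/
lemma exists_regular (hD : ∀ X : D, Projective X) {X Y : D} (f : X ⟶ Y) :
    ∃ t : Y ⟶ X, f ≫ t ≫ f = f := by
  have := hD
  -- `s` is a section of the epimorphism onto the image, `r` a retraction of the image inclusion.
  let s := Projective.factorThru (𝟙 (image f)) (factorThruImage f)
  have hs : s ≫ factorThruImage f = 𝟙 _ := Projective.factorThru_comp _ _
  let σ := Projective.factorThru (𝟙 (cokernel (image.ι f))) (cokernel.π (image.ι f))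
  have hσ : σ ≫ cokernel.π (image.ι f) = 𝟙 _ := Projective.factorThru_comp _ _
  let r := (Abelian.monoLift (image.ι f) (𝟙 Y - cokernel.π (image.ι f) ≫ σ) (by
    rw [Preadditive.sub_comp, Category.assoc, hσ]; simp))
  have hr : r ≫ image.ι f = 𝟙 Y - cokernel.π (image.ι f) ≫ σ := Abelian.monoLift_comp _ _ _
  have hr' : image.ι f ≫ r = 𝟙 _ := by
    rw [← cancel_mono (image.ι f), Category.assoc, hr]
    simp
  refine ⟨r ≫ s, ?_⟩
  have hf : f = factorThruImage f ≫ image.ι f := (image.fac f).symm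
  calc f ≫ (r ≫ s) ≫ f
      = (factorThruImage f ≫ image.ι f) ≫ (r ≫ s) ≫ (factorThruImage f ≫ image.ι f) := by
        rw [image.fac]
    _ = f := by
        simp only [Category.assoc]
        rw [reassoc_of% hr', reassoc_of% hs, image.fac]

end Abelian

section Linear

variable [Preadditive D] [Linear ℂ D]

/-- The dimension of the endomorphism algebra decreases along proper retracts. -/
lemma finrank_end_lt (hD : ∀ X : D, Module.Finite ℂ (X ⟶ X)) {K X : D} (i : K ⟶ X) (r : X ⟶ K)
    (h : i ≫ r = 𝟙 K) (h' : r ≫ i ≠ 𝟙 X) :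
    Module.finrank ℂ (K ⟶ K) < Module.finrank ℂ (X ⟶ X) := by
  have := hD
  let φ : (K ⟶ K) →ₗ[ℂ] (X ⟶ X) :=
    { toFun := fun f => r ≫ f ≫ i
      map_add' := by simp
      map_smul' := by simp }
  have hφ : Function.Injective φ := by
    intro f g hfg
    have : i ≫ (r ≫ f ≫ i) ≫ r = i ≫ (r ≫ g ≫ i) ≫ r := congrArg (fun t => i ≫ t ≫ r) hfg
    simpa [reassoc_of% h, h] using this
  rw [← LinearMap.finrank_range_of_inj hφ]
  apply Submodule.finrank_lt
  intro htop
  obtain ⟨f, hf⟩ : 𝟙 X ∈ LinearMap.range φ := htop ▸ Submodule.mem_top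
  apply h'
  have hf : r ≫ f ≫ i = 𝟙 X := hf
  calc r ≫ i = r ≫ i ≫ (r ≫ f ≫ i) := by rw [hf, Category.comp_id]
    _ = 𝟙 X := by rw [reassoc_of% h, hf]

end Linear

/-- `G` generates `Y` if the identity of `Y` is a sum of morphisms that factor through `G`. -/
def Generates [Preadditive D] (G Y : D) : Prop :=
  𝟙 Y ∈ AddSubmonoid.closure {h : Y ⟶ Y | ∃ (f : Y ⟶ G) (g : G ⟶ Y), h = f ≫ g}

/-- If `G` generates `K`, then a morphism that factors through `K` is a sum of morphisms that factor
through `G`. -/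
lemma generates_sandwich [Preadditive D] {G K Y : D} (h : Generates G K) (r : Y ⟶ K) (i : K ⟶ Y) :
    r ≫ i ∈ AddSubmonoid.closure {h : Y ⟶ Y | ∃ (f : Y ⟶ G) (g : G ⟶ Y), h = f ≫ g} := by
  suffices H : ∀ k ∈ AddSubmonoid.closure {h : K ⟶ K | ∃ (f : K ⟶ G) (g : G ⟶ K), h = f ≫ g},
      r ≫ k ≫ i ∈ AddSubmonoid.closure {h : Y ⟶ Y | ∃ (f : Y ⟶ G) (g : G ⟶ Y), h = f ≫ g} by
    simpa using H _ h
  intro k hk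
  induction hk using AddSubmonoid.closure_induction with
  | mem k hk =>
    obtain ⟨f, g, rfl⟩ := hk
    exact AddSubmonoid.subset_closure ⟨r ≫ f, g ≫ i, by simp⟩
  | zero => simp
  | add k k' _ _ hk hk' =>
    rw [Preadditive.add_comp, Preadditive.comp_add]
    exact add_mem hk hk'

/-- A finitely semisimple category has an object that generates all objects: the sum of the simple
objects. An object that is not simple splits into summands with smaller endomorphism algebras. -/
lemma exists_generator [Abelian D] [Linear ℂ D] [FinitelySemisimple D] :
    ∃ G : D, ∀ Y, Generates G Y := by
  have := Abelian.hasFiniteBiproducts (C := D)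
  obtain ⟨n, L, hL⟩ := FinitelySemisimple.finite_simples (C := D)
  refine ⟨⨁ L, fun Y => ?_⟩
  induction hd : Module.finrank ℂ (Y ⟶ Y) using Nat.strong_induction_on generalizing Y with
  | _ d ih =>
  subst hd
  by_cases hY : Simple Y
  · obtain ⟨i, ⟨e⟩⟩ := hL Y hY
    exact AddSubmonoid.subset_closure
      ⟨e.hom ≫ biproduct.ι L i, biproduct.π L i ≫ e.inv, by simp⟩
  by_cases hY0 : 𝟙 Y = 0
  · rw [Generates, hY0]
    exact zero_mem _
  obtain ⟨Z, f, hf, hfi, hf0⟩ : ∃ (Z : D) (f : Z ⟶ Y), Mono f ∧ ¬ IsIso f ∧ f ≠ 0 := by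
    by_contra! H
    refine hY ⟨fun {Z} f hf => ⟨?_, fun hf0 => ?_⟩⟩
    · rintro hfi rfl
      apply hY0
      rw [← IsIso.inv_hom_id (0 : Z ⟶ Y), comp_zero]
    · by_contra hfi
      exact hf0 (H Z f hf hfi)
  obtain ⟨t, ht⟩ := exists_regular FinitelySemisimple.projective f
  have ht : f ≫ t = 𝟙 Z := by
    rw [← cancel_mono f, Category.assoc, ht, Category.id_comp]
  obtain ⟨K, i, r, hir, hri⟩ := IsIdempotentComplete.idempotents_split Y (𝟙 Y - t ≫ f) (by
    simp [reassoc_of% ht])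
  have h₁ : t ≫ f ≠ 𝟙 Y := fun h => hfi ⟨t, ht, h⟩
  have h₂ : r ≫ i ≠ 𝟙 Y := by
    intro h
    rw [hri, sub_eq_self] at h
    apply hf0
    rw [← Category.id_comp f, ← ht, Category.assoc, h, comp_zero]
  have hY : 𝟙 Y = t ≫ f + r ≫ i := by rw [hri]; abel
  have hfin (X : D) : Module.Finite ℂ (X ⟶ X) := FinitelySemisimple.finite_hom X X
  rw [Generates, hY]
  exact add_mem (generates_sandwich (ih _ (finrank_end_lt hfin f t ht h₁) Z rfl) t f)
    (generates_sandwich (ih _ (finrank_end_lt hfin i r hir h₂) K rfl) r i)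

/-- A universal arrow from `e` to an additive functor `F` exists if the morphisms from `e` to the
value of `F` at a generator are finitely generated. It is a weakly universal arrow whose target is
minimal with respect to `d`. -/
lemma exists_universal [Preadditive D] [HasFiniteBiproducts D] [IsIdempotentComplete D]
    (hreg : ∀ {X Y : D} (f : X ⟶ Y), ∃ t : Y ⟶ X, f ≫ t ≫ f = f) (d : D → ℕ)
    (hd : ∀ {K X : D} (i : K ⟶ X) (r : X ⟶ K), i ≫ r = 𝟙 K → r ≫ i ≠ 𝟙 X → d K < d X)
    {G : D} (hG : ∀ Y, Generates G Y) {E : Type u₁} [Category.{v₁} E] [Preadditive E]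
    (F : D ⥤ E) [F.Additive] (e : E) {n : ℕ} (b : Fin n → (e ⟶ F.obj G))
    (hb : ∀ y : e ⟶ F.obj G, ∃ h : Fin n → (G ⟶ G), y = ∑ k, b k ≫ F.map (h k)) :
    ∃ (X : D) (x : e ⟶ F.obj X), ∀ Y, Function.Bijective fun f : X ⟶ Y => x ≫ F.map f := by
  let W : Set D := {X | ∃ x : e ⟶ F.obj X, ∀ Y, Function.Surjective fun f : X ⟶ Y => x ≫ F.map f}
  -- The sum of `n` copies of the generator, with the arrow given by `b`, is weakly universal.
  have hW : W.Nonempty := by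
    refine ⟨⨁ fun _ : Fin n => G, ∑ k, b k ≫ F.map (biproduct.ι (fun _ : Fin n => G) k),
      fun Y y => ?_⟩
    suffices H : ∀ k ∈ AddSubmonoid.closure {h : Y ⟶ Y | ∃ (f : Y ⟶ G) (g : G ⟶ Y), h = f ≫ g},
        ∃ f : (⨁ fun _ : Fin n => G) ⟶ Y,
          (∑ k, b k ≫ F.map (biproduct.ι (fun _ : Fin n => G) k)) ≫ F.map f = y ≫ F.map k by
      obtain ⟨f, hf⟩ := H _ (hG Y)
      exact ⟨f, by simpa using hf⟩
    intro k hk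
    induction hk using AddSubmonoid.closure_induction with
    | mem k hk =>
      obtain ⟨f, g, rfl⟩ := hk
      obtain ⟨h, hh⟩ := hb (y ≫ F.map f)
      refine ⟨biproduct.desc fun k => h k ≫ g, ?_⟩
      rw [F.map_comp, reassoc_of% hh, Preadditive.sum_comp, Preadditive.sum_comp]
      refine Finset.sum_congr rfl fun k _ => ?_
      rw [Category.assoc, ← F.map_comp, biproduct.ι_desc, F.map_comp, Category.assoc]
    | zero => exact ⟨0, by simp⟩
    | add k k' _ _ hk hk' =>
      obtain ⟨f, hf⟩ := hk
      obtain ⟨f', hf'⟩ := hk'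
      exact ⟨f + f', by
        rw [F.map_add, F.map_add, Preadditive.comp_add, Preadditive.comp_add, hf, hf']⟩
  obtain ⟨X, ⟨x, hx⟩, hmin⟩ : ∃ X ∈ W, ∀ Y ∈ W, d X ≤ d Y := by
    obtain ⟨X, hX, h⟩ := (InvImage.wf d Nat.lt_wfRel.wf).has_min W hW
    exact ⟨X, hX, fun Y hY => not_lt.1 (h Y hY)⟩
  refine ⟨X, x, fun Y => ⟨fun f g hfg => ?_, hx Y⟩⟩
  -- If `x` equalizes `f` and `g`, then it factors through the complement `K` of the coimage of
  -- `f - g`, so that `K` is all of `X` by minimality.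
  obtain ⟨t, ht⟩ := hreg (f - g)
  obtain ⟨K, i, r, hir, hri⟩ := IsIdempotentComplete.idempotents_split X (𝟙 X - (f - g) ≫ t) (by
    rw [Preadditive.sub_comp, Category.id_comp, Preadditive.comp_sub, Category.comp_id,
      Category.assoc, reassoc_of% ht]
    simp)
  have hxi : x ≫ F.map r ≫ F.map i = x := by
    rw [← F.map_comp, hri, F.map_sub, F.map_comp, F.map_sub, Preadditive.comp_sub,
      Preadditive.sub_comp, Preadditive.comp_sub, ← Category.assoc, ← Category.assoc]
    simp only at hfg
    rw [hfg]
    simp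
  have hK : K ∈ W := ⟨x ≫ F.map r, fun Y y => by
    obtain ⟨f, hf⟩ := hx Y y
    refine ⟨i ≫ f, ?_⟩
    simp only [F.map_comp, Category.assoc] at hf ⊢
    rw [← hf, reassoc_of% hxi]⟩
  have h1 : r ≫ i = 𝟙 X := by
    by_contra h
    exact absurd (hd i r hir h) (not_lt.2 (hmin K hK))
  rw [hri, sub_eq_self] at h1
  rw [← sub_eq_zero, ← ht, reassoc_of% h1, zero_comp]

/-- A co-universal arrow from an additive functor `F` to `e` exists if the morphisms to `e` from the
value of `F` at a generator are finitely generated. -/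
lemma exists_couniversal [Preadditive D] [HasFiniteBiproducts Dᵒᵖ] [IsIdempotentComplete D]
    (hreg : ∀ {X Y : D} (f : X ⟶ Y), ∃ t : Y ⟶ X, f ≫ t ≫ f = f) (d : D → ℕ)
    (hd : ∀ {K X : D} (i : K ⟶ X) (r : X ⟶ K), i ≫ r = 𝟙 K → r ≫ i ≠ 𝟙 X → d K < d X)
    {G : D} (hG : ∀ Y, Generates G Y) {E : Type u₁} [Category.{v₁} E] [Preadditive E]
    (F : D ⥤ E) [F.Additive] (e : E) {n : ℕ} (b : Fin n → (F.obj G ⟶ e))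
    (hb : ∀ y : F.obj G ⟶ e, ∃ h : Fin n → (G ⟶ G), y = ∑ k, F.map (h k) ≫ b k) :
    ∃ (X : D) (x : F.obj X ⟶ e), ∀ Y, Function.Bijective fun f : Y ⟶ X => F.map f ≫ x := by
  obtain ⟨X, x, hx⟩ := exists_universal (D := Dᵒᵖ)
    (fun {X Y} f => by
      obtain ⟨t, ht⟩ := hreg f.unop
      exact ⟨t.op, Quiver.Hom.unop_inj (by simpa using ht)⟩)
    (fun X => d X.unop)
    (fun {K X} i r h h' => hd r.unop i.unop (Quiver.Hom.op_inj h)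
      (fun h'' => h' (Quiver.Hom.unop_inj h'')))
    (G := Opposite.op G)
    (fun Y => by
      suffices H : ∀ k ∈ AddSubmonoid.closure
          {h : Y.unop ⟶ Y.unop | ∃ (f : Y.unop ⟶ G) (g : G ⟶ Y.unop), h = f ≫ g},
          k.op ∈ AddSubmonoid.closure
            {h : Y ⟶ Y | ∃ (f : Y ⟶ Opposite.op G) (g : Opposite.op G ⟶ Y), h = f ≫ g} from
        H _ (hG Y.unop)
      intro k hk
      induction hk using AddSubmonoid.closure_induction with
      | mem k hk =>
        obtain ⟨f, g, rfl⟩ := hk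
        exact AddSubmonoid.subset_closure ⟨g.op, f.op, rfl⟩
      | zero => exact zero_mem _
      | add k k' _ _ hk hk' => exact add_mem hk hk')
    F.op (Opposite.op e) (fun k => (b k).op)
    (fun y => by
      obtain ⟨h, hh⟩ := hb y.unop
      refine ⟨fun k => (h k).op, Quiver.Hom.unop_inj ?_⟩
      rw [hh, unop_sum]
      rfl)
  refine ⟨X.unop, x.unop, fun Y => ⟨fun f g h => ?_, fun y => ?_⟩⟩
  · exact Quiver.Hom.op_inj ((hx (Opposite.op Y)).1 (Quiver.Hom.unop_inj h))
  · obtain ⟨f, hf⟩ := (hx (Opposite.op Y)).2 y.op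
    exact ⟨f.unop, Quiver.Hom.op_inj hf⟩

end Semisimple

/-! ### Existence of adjoints -/

section Existence

open MonoidalLeftAction

variable {C : Type u} [Category.{v} C] [Abelian C] [Linear ℂ C] [MonoidalCategory C]
  {S : Type u₁} [Category.{v₁} S] [Abelian S] [Linear ℂ S]
  [MonoidalLeftAction C S] [BilinearAction C S]

instance actOn_additive (m : S) : (actOn C m).Additive where
  map_add {_ _ f g} := BilinearAction.add_actionHomLeft f g m

/-- A module functor is automatically `ℂ`-linear: scalars act through the tensor unit. -/
lemma map_smul_of_leftLinear [MonoidalPreadditive C] [MonoidalLinear ℂ C]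
    (F : S ⥤ C) [F.LeftLinear C] {s s' : S} (z : ℂ) (f : s ⟶ s') :
    F.map (z • f) = z • F.map f := by
  have h₁ : z • 𝟙 s = (λₗ[C] s).inv ≫ (z • 𝟙 (𝟙_ C)) ⊵ₗ s ≫ (λₗ s).hom := by
    rw [BilinearAction.smul_actionHomLeft]
    simp
  have h₂ : F.map (z • 𝟙 s) = z • 𝟙 (F.obj s) := by
    rw [h₁, F.map_comp, F.map_comp, ← cancel_epi (F.map (λₗ[C] s).hom),
      ← cancel_epi (str F (𝟙_ C) s).hom, ← F.map_comp_assoc, Iso.hom_inv_id, F.map_id,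
      Category.id_comp, ← str_naturality_left_assoc, MonoidalLinear.smul_whiskerRight]
    simp
  have h₃ : z • f = (z • 𝟙 s) ≫ f := by simp
  rw [h₃, F.map_comp, h₂]
  simp

variable [FinitelySemisimple S] [FinitelySemisimple C]

/-- The morphisms `𝟙_ C ⟶ M s` are represented by an object of `S`. -/
lemma exists_universal_of_moduleFunctor [MonoidalPreadditive C] [MonoidalLinear ℂ C]
    (M : ModuleFunctor C S C) :
    ∃ (m : S) (u : 𝟙_ C ⟶ M.functor.obj m),
      ∀ s, Function.Bijective fun f : m ⟶ s => u ≫ M.functor.map f := by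
  have := Abelian.hasFiniteBiproducts (C := S)
  obtain ⟨G, hG⟩ := exists_generator (D := S)
  have hfin : Module.Finite ℂ (𝟙_ C ⟶ M.functor.obj G) := FinitelySemisimple.finite_hom _ _
  let b := Module.finBasis ℂ (𝟙_ C ⟶ M.functor.obj G)
  refine exists_universal (exists_regular FinitelySemisimple.projective) _
    (finrank_end_lt fun X => FinitelySemisimple.finite_hom X X) hG M.functor (𝟙_ C) b
    fun y => ⟨fun k => b.repr y k • 𝟙 G, ?_⟩
  conv_lhs => rw [← b.sum_repr y]
  simp [map_smul_of_leftLinear]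

/-- The action on an object `m` of `S` has a right adjoint, the internal Hom functor of `m`. -/
lemma isLeftAdjoint_actOn (m : S) : (actOn C m).IsLeftAdjoint := by
  have := Abelian.hasFiniteBiproducts (C := Cᵒᵖ)
  obtain ⟨G, hG⟩ := exists_generator (D := C)
  have (s : S) : ∃ (X : C) (x : (actOn C m).obj X ⟶ s),
      ∀ Y, Function.Bijective fun f : Y ⟶ X => (actOn C m).map f ≫ x := by
    have hfin : Module.Finite ℂ (G ⊙ₗ m ⟶ s) := FinitelySemisimple.finite_hom _ _
    let b := Module.finBasis ℂ (G ⊙ₗ m ⟶ s)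
    refine exists_couniversal (exists_regular FinitelySemisimple.projective) _
      (finrank_end_lt fun X => FinitelySemisimple.finite_hom X X) hG (actOn C m) s b
      fun y => ⟨fun k => b.repr y k • 𝟙 G, (b.sum_repr y).symm.trans ?_⟩
    refine Finset.sum_congr rfl fun k _ => ?_
    change b.repr y k • b k = (b.repr y k • 𝟙 G) ⊵ₗ m ≫ b k
    simp [BilinearAction.smul_actionHomLeft]
  choose X x hx using this
  exact ⟨_, ⟨Adjunction.adjunctionOfEquivRight (F := actOn C m)
    (fun c s => (Equiv.ofBijective _ (hx s c)).symm)
    (by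
      intro c c' s f g
      rw [Equiv.symm_apply_eq]
      have := (Equiv.ofBijective _ (hx s c')).apply_symm_apply g
      simp only [Equiv.ofBijective_apply, Functor.map_comp, Category.assoc] at this ⊢
      rw [this])⟩⟩

/-- There is a non-degenerate module functor `S ⥤ C`: the internal Hom functor of a generator. -/
lemma exists_nondegenerate [RigidCategory C] : ∃ M : ModuleFunctor C S C, M.IsNondegenerate := by
  obtain ⟨G, hG⟩ := exists_generator (D := S)
  have := isLeftAdjoint_actOn (C := C) G
  let adj := Adjunction.ofIsLeftAdjoint (actOn C G)
  refine ⟨⟨(actOn C G).rightAdjoint, adj.right_adjoint_additive, rightAdjointLeftLinear adj⟩,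
    fun s hs hz => hs ?_⟩
  have h0 (f : G ⟶ s) : f = 0 := by
    have h : (λₗ[C] G).hom ≫ f = 0 :=
      (adj.homEquiv (𝟙_ C) s).injective (hz.eq_of_tgt _ _)
    rw [← cancel_epi (λₗ[C] G).hom, h, comp_zero]
  rw [IsZero.iff_id_eq_zero]
  suffices H : ∀ k ∈ AddSubmonoid.closure {h : s ⟶ s | ∃ (f : s ⟶ G) (g : G ⟶ s), h = f ≫ g},
      k = 0 from H _ (hG s)
  intro k hk
  induction hk using AddSubmonoid.closure_induction with
  | mem k hk =>
    obtain ⟨f, g, rfl⟩ := hk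
    rw [h0 g, comp_zero]
  | zero => rfl
  | add k k' _ _ hk hk' => rw [hk, hk', add_zero]

end Existence

/-! ### The pivotal structure of a ribbon category -/

section Pivotal

open ModularTensorCategory BraidedCategory

/-- The mate of a morphism with respect to two exact pairings. -/
lemma exists_mate {C : Type u} [Category.{v} C] [MonoidalCategory C] {X X' Y Y' : C}
    [ExactPairing X X'] [ExactPairing Y Y'] (f : X ⟶ Y) :
    ∃ f' : Y' ⟶ X', f' ▷ X ≫ ε_ X X' = Y' ◁ f ≫ ε_ Y Y' ∧
      η_ X X' ≫ f ▷ X' = η_ Y Y' ≫ Y ◁ f' := by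
  let : HasRightDual X := ⟨X'⟩
  let : HasRightDual Y := ⟨Y'⟩
  exact ⟨fᘁ, rightAdjointMate_comp_evaluation f, (coevaluation_comp_rightAdjointMate f).symm⟩

/-- A strand is pulled across a cap. -/
lemma braid_cap {C : Type u} [Category.{v} C] [MonoidalCategory C] [BraidedCategory C] {P Q : C}
    (Z : C) (c : P ⊗ Q ⟶ 𝟙_ C) :
    (β_ Z (P ⊗ Q)).hom ≫ c ▷ Z = Z ◁ c ≫ (ρ_ Z).hom ≫ (λ_ Z).inv := by
  rw [← braiding_naturality_right, braiding_tensorUnit_right]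

/-- A strand is pulled across a cap, with the crossing of the strand with the two legs of the cap
written as two crossings. -/
lemma braid_cap' {C : Type u} [Category.{v} C] [MonoidalCategory C] [BraidedCategory C] {P Q : C}
    (Z : C) (c : P ⊗ Q ⟶ 𝟙_ C) :
    𝟙 (Z ⊗ P ⊗ Q) ⊗≫ (β_ Z P).hom ▷ Q ⊗≫ P ◁ (β_ Z Q).hom ⊗≫ c ▷ Z =
      Z ◁ c ⊗≫ 𝟙 (𝟙_ C ⊗ Z) := by
  have h := braid_cap Z c
  rw [braiding_tensor_right_hom] at h
  have h' : Z ◁ c ⊗≫ 𝟙 (𝟙_ C ⊗ Z) = Z ◁ c ≫ (ρ_ Z).hom ≫ (λ_ Z).inv := by monoidal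
  rw [h', ← h]
  monoidal

variable {C : Type u} [Category.{v} C] [Abelian C] [Linear ℂ C]
  [MonoidalCategory C] [MonoidalPreadditive C] [MonoidalLinear ℂ C] [BraidedCategory C]
  [RigidCategory C] [ModularTensorCategory C]

/-- The evaluation `X ⊗ X' ⟶ 𝟙` given by the ribbon structure, for an exact pairing of `X` and
`X'`. -/
def evR (X X' : C) [ExactPairing X X'] : X ⊗ X' ⟶ 𝟙_ C :=
  (twist X).hom ▷ X' ≫ (β_ X X').hom ≫ ε_ X X'

lemma ev'_eq (X : C) : ev' X = evR X Xᘁ := rfl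

/-- The ribbon evaluation intertwines a morphism and its mate: the pivotal structure is natural. -/
lemma whiskerLeft_mate_evR {X X' Y Y' : C} [ExactPairing X X'] [ExactPairing Y Y'] {f : X ⟶ Y}
    {f' : Y' ⟶ X'} (h : f' ▷ X ≫ ε_ X X' = Y' ◁ f ≫ ε_ Y Y') :
    X ◁ f' ≫ evR X X' = f ▷ Y' ≫ evR Y Y' := by
  rw [evR, evR, whisker_exchange_assoc, braiding_naturality_right_assoc, h,
    ← comp_whiskerRight_assoc, twist_naturality, comp_whiskerRight_assoc,
    braiding_naturality_left_assoc f]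

/-- The ribbon evaluation of a tensor product is the nested evaluation of the factors: the pivotal
structure is monoidal. -/
lemma evR_tensor (X A X' A' : C) [ExactPairing X X'] [ExactPairing A A'] :
    evR (X ⊗ A) (A' ⊗ X') = 𝟙 _ ⊗≫ X ◁ evR A A' ▷ X' ⊗≫ evR X X' := by
  have key : (β_ X A).hom ▷ (A' ⊗ X') ≫ (β_ (A ⊗ X) (A' ⊗ X')).hom ≫
      (A' ⊗ X') ◁ (β_ A X).hom ≫ ε_ (X ⊗ A) (A' ⊗ X') =
      𝟙 ((X ⊗ A) ⊗ A' ⊗ X') ⊗≫ X ◁ ((β_ A A').hom ≫ ε_ A A') ▷ X' ⊗≫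
        (β_ X X').hom ≫ ε_ X X' := by
    have h₁ := braid_cap' A (ε_ X X')
    have h₂ := braid_cap' X ((β_ A A').hom ≫ ε_ A A')
    calc _ = 𝟙 ((X ⊗ A) ⊗ A' ⊗ X') ⊗≫ (β_ X A).hom ▷ A' ▷ X' ⊗≫ A ◁ (β_ X A').hom ▷ X' ⊗≫
          (β_ A A').hom ▷ X ▷ X' ⊗≫ A' ◁ (A ◁ (β_ X X').hom ⊗≫
            (𝟙 (A ⊗ X' ⊗ X) ⊗≫ (β_ A X').hom ▷ X ⊗≫ X' ◁ (β_ A X).hom ⊗≫ ε_ X X' ▷ A)) ⊗≫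
              ε_ A A' := by
          rw [ExactPairing.tensor_evaluation]
          simp only [braiding_tensor_left_hom, braiding_tensor_right_hom]
          monoidal
      _ = 𝟙 ((X ⊗ A) ⊗ A' ⊗ X') ⊗≫ (β_ X A).hom ▷ A' ▷ X' ⊗≫ A ◁ (β_ X A').hom ▷ X' ⊗≫
          ((β_ A A').hom ▷ (X ⊗ X') ≫ (A' ⊗ A) ◁ ((β_ X X').hom ≫ ε_ X X')) ⊗≫ ε_ A A' := by
          -- The inner cap `ε_ X X'` is pulled across the strand `A`.
          rw [h₁]
          monoidal
      _ = 𝟙 ((X ⊗ A) ⊗ A' ⊗ X') ⊗≫ (β_ X A).hom ▷ A' ▷ X' ⊗≫ A ◁ (β_ X A').hom ▷ X' ⊗≫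
          ((A ⊗ A') ◁ ((β_ X X').hom ≫ ε_ X X') ≫
            ((β_ A A').hom ≫ ε_ A A') ▷ 𝟙_ C) ⊗≫ 𝟙 (𝟙_ C) := by
          rw [← whisker_exchange]
          monoidal
      _ = 𝟙 ((X ⊗ A) ⊗ A' ⊗ X') ⊗≫ (𝟙 (X ⊗ A ⊗ A') ⊗≫ (β_ X A).hom ▷ A' ⊗≫
          A ◁ (β_ X A').hom ⊗≫ ((β_ A A').hom ≫ ε_ A A') ▷ X) ▷ X' ⊗≫
            ((β_ X X').hom ≫ ε_ X X') ⊗≫ 𝟙 (𝟙_ C) := by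
          rw [whisker_exchange]
          monoidal
      _ = _ := by
          -- The cap on `A` and `A'` is pulled across the strand `X`.
          rw [h₂]
          monoidal
  -- The double braiding in the twist of `X ⊗ A` is distributed to both sides of the large crossing.
  have h : evR (X ⊗ A) (A' ⊗ X') = ((twist X).hom ⊗ₘ (twist A).hom) ▷ (A' ⊗ X') ≫
      (β_ X A).hom ▷ (A' ⊗ X') ≫ (β_ (A ⊗ X) (A' ⊗ X')).hom ≫
        (A' ⊗ X') ◁ (β_ A X).hom ≫ ε_ (X ⊗ A) (A' ⊗ X') := by
    rw [evR, twist_tensor, ← braiding_naturality_left_assoc]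
    simp only [comp_whiskerRight, Category.assoc]
  rw [h, key, evR, evR, MonoidalCategory.tensorHom_def]
  calc _ = (𝟙 ((X ⊗ A) ⊗ A' ⊗ X') ⊗≫ ((twist X).hom ▷ ((A ⊗ A') ⊗ X') ≫
        X ◁ (((twist A).hom ▷ A' ≫ (β_ A A').hom ≫ ε_ A A') ▷ X')) ⊗≫
          (β_ X X').hom ≫ ε_ X X') := by
        monoidal
    _ = _ := by
      rw [← whisker_exchange]
      monoidal

/-- The twist of the tensor unit is trivial: it is an automorphism whose square is itself. -/
lemma twist_unit : (twist (𝟙_ C)).hom = 𝟙 (𝟙_ C) := by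
  have h₁ := twist_naturality (λ_ (𝟙_ C)).hom
  rw [twist_tensor] at h₁
  have h₂ : (β_ (𝟙_ C) (𝟙_ C)).hom ≫ (β_ (𝟙_ C) (𝟙_ C)).hom ≫ (λ_ (𝟙_ C)).hom =
      (λ_ (𝟙_ C)).hom := by
    rw [braiding_leftUnitor, ← unitors_equal, braiding_leftUnitor, ← unitors_equal]
  rw [Category.assoc, Category.assoc, h₂, MonoidalCategory.tensorHom_def, Category.assoc,
    leftUnitor_naturality, unitors_equal, rightUnitor_naturality_assoc, cancel_epi] at h₁
  exact (cancel_epi (twist (𝟙_ C)).hom).1 (by rw [← h₁, Category.comp_id])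

/-- The coevaluation `coev'` in terms of the inverse braiding and the inverse twist. The two
expressions agree because the twist of `X ⊗ Xᘁ` is compatible with the coevaluation and the twist of
`Xᘁ` is dual to that of `X`. -/
lemma coev'_eq (X : C) : coev' X = η_ X Xᘁ ≫ (β_ Xᘁ X).inv ≫ Xᘁ ◁ (twist X).inv := by
  have h : η_ X Xᘁ ≫ (β_ X Xᘁ).hom ≫ Xᘁ ◁ (twist X).hom ≫ Xᘁ ◁ (twist X).hom ≫ (β_ Xᘁ X).hom =
      η_ X Xᘁ := by
    have h₁ := twist_naturality (η_ X Xᘁ)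
    rw [twist_unit, Category.id_comp, twist_tensor, twist_dual, MonoidalCategory.tensorHom_def',
      Category.assoc, coevaluation_comp_rightAdjointMate_assoc, braiding_naturality_left_assoc,
      braiding_naturality_left_assoc] at h₁
    exact h₁
  conv_rhs => rw [← h]
  simp [coev']

/-- One of the zigzag identities for the second duality `(Xᘁ, coev', ev')`. -/
lemma coev'_ev' (X : C) :
    X ◁ coev' X ≫ (α_ _ _ _).inv ≫ ev' X ▷ X = (ρ_ X).hom ≫ (λ_ X).inv := by
  -- The braiding makes `X` and `Xᘁ` into an exact pairing in the opposite order; the twists cancel.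
  let := exactPairing_swap X Xᘁ
  have h : X ◁ (η_ X Xᘁ ≫ (β_ Xᘁ X).inv) ≫ (α_ _ _ _).inv ≫ ((β_ X Xᘁ).hom ≫ ε_ X Xᘁ) ▷ X =
    (ρ_ X).hom ≫ (λ_ X).inv := ExactPairing.coevaluation_evaluation Xᘁ X
  rw [coev'_eq, ev']
  calc _ = 𝟙 (X ⊗ 𝟙_ C) ⊗≫ X ◁ (η_ X Xᘁ ≫ (β_ Xᘁ X).inv) ⊗≫
        ((X ⊗ Xᘁ) ◁ (twist X).inv ≫ ((twist X).hom ▷ Xᘁ) ▷ X) ⊗≫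
          ((β_ X Xᘁ).hom ≫ ε_ X Xᘁ) ▷ X := by
        monoidal
    _ = 𝟙 (X ⊗ 𝟙_ C) ⊗≫ (X ◁ (η_ X Xᘁ ≫ (β_ Xᘁ X).inv) ≫ (twist X).hom ▷ (Xᘁ ⊗ X)) ⊗≫
        (((X ⊗ Xᘁ) ◁ (twist X).inv) ≫ ((β_ X Xᘁ).hom ≫ ε_ X Xᘁ) ▷ X) ⊗≫ 𝟙 (𝟙_ C ⊗ X) := by
        rw [whisker_exchange]
        monoidal
    _ = (twist X).hom ▷ 𝟙_ C ≫ (X ◁ (η_ X Xᘁ ≫ (β_ Xᘁ X).inv) ≫ (α_ _ _ _).inv ≫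
        ((β_ X Xᘁ).hom ≫ ε_ X Xᘁ) ▷ X) ≫ 𝟙_ C ◁ (twist X).inv := by
        rw [whisker_exchange, whisker_exchange]
        monoidal
    _ = _ := by
        rw [h]
        simp

/-- The pairing `ev'` is nondegenerate in its second argument. -/
lemma hom_ext_ev' {X Y : C} {f g : Y ⟶ Xᘁ} (h : X ◁ f ≫ ev' X = X ◁ g ≫ ev' X) : f = g := by
  have h' : f ▷ X ≫ ε_ X Xᘁ = g ▷ X ≫ ε_ X Xᘁ := by
    simpa only [ev', whisker_exchange_assoc, braiding_naturality_right_assoc,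
      cancel_epi] using h
  have (k : Y ⟶ Xᘁ) : k = (tensorRightHomEquiv Y X Xᘁ (𝟙_ C) (k ▷ X ≫ ε_ X Xᘁ)) ≫ (λ_ _).hom := by
    rw [← cancel_mono (λ_ Xᘁ).inv, Category.assoc, Iso.hom_inv_id, Category.comp_id,
      ← Equiv.symm_apply_eq]
    simp [tensorRightHomEquiv, ← unitors_equal]
  rw [this f, h', ← this g]

/-- The trace of an endomorphism, as an endomorphism of the tensor unit. -/
def tr {X : C} (f : X ⟶ X) : 𝟙_ C ⟶ 𝟙_ C := η_ X Xᘁ ≫ f ▷ Xᘁ ≫ ev' X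

lemma tr_comp_comm {X Y : C} (f : X ⟶ Y) (g : Y ⟶ X) : tr (f ≫ g) = tr (g ≫ f) := by
  obtain ⟨f', h₁, h₂⟩ := exists_mate (X' := Xᘁ) (Y' := Yᘁ) f
  rw [tr, tr, comp_whiskerRight, comp_whiskerRight, Category.assoc, Category.assoc, reassoc_of% h₂,
    ev'_eq, ev'_eq, ← whiskerLeft_mate_evR h₁, whisker_exchange_assoc]

lemma tr_id (X : C) : tr (𝟙 X) = qdim X := by simp [tr, qdim]

/-- The partial trace of a morphism `Y ⊗ A ⟶ A` over `A`. -/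
def ptr {Y A : C} (f : Y ⊗ A ⟶ A) : Y ⟶ 𝟙_ C :=
  (ρ_ Y).inv ≫ Y ◁ η_ A Aᘁ ≫ (α_ _ _ _).inv ≫ f ▷ Aᘁ ≫ ev' A

lemma comp_ptr {Y Y' A : C} (g : Y' ⟶ Y) (f : Y ⊗ A ⟶ A) : g ≫ ptr f = ptr (g ▷ A ≫ f) := by
  rw [ptr, ptr, rightUnitor_inv_naturality_assoc, ← whisker_exchange_assoc]
  simp

/-- Cyclicity of the partial trace: a tensor factor `X` that acts on the traced object can be
carried around the loop. -/
lemma ptr_cyclic {X Y A B : C} (F : X ⊗ A ⟶ B) (G : Y ⊗ B ⟶ A) :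
    X ◁ ((ρ_ Y).inv ≫ Y ◁ η_ X Xᘁ ≫ (α_ _ _ _).inv ≫
      ptr ((α_ Y X A).hom ≫ Y ◁ F ≫ G) ▷ Xᘁ ≫ (λ_ _).hom) ≫ ev' X =
    ptr ((α_ X Y B).hom ≫ X ◁ G ≫ F) := by
  -- The mate of `F` carries `F` from the coevaluation to the ribbon evaluation.
  obtain ⟨F', h₁, h₂⟩ := exists_mate (X' := Aᘁ ⊗ Xᘁ) (Y' := Bᘁ) F
  have h₃ := whiskerLeft_mate_evR h₁
  simp only [ptr, ev'_eq]
  calc _ = 𝟙 _ ⊗≫ (X ⊗ Y) ◁ (η_ (X ⊗ A) (Aᘁ ⊗ Xᘁ) ≫ F ▷ (Aᘁ ⊗ Xᘁ)) ⊗≫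
        X ◁ G ▷ (Aᘁ ⊗ Xᘁ) ⊗≫ evR (X ⊗ A) (Aᘁ ⊗ Xᘁ) := by
        rw [evR_tensor, ExactPairing.tensor_coevaluation]
        monoidal
    _ = 𝟙 _ ⊗≫ (X ⊗ Y) ◁ η_ B Bᘁ ⊗≫ X ◁ ((Y ⊗ B) ◁ F' ≫ G ▷ (Aᘁ ⊗ Xᘁ)) ⊗≫
        evR (X ⊗ A) (Aᘁ ⊗ Xᘁ) := by
        rw [h₂]
        monoidal
    _ = 𝟙 _ ⊗≫ (X ⊗ Y) ◁ η_ B Bᘁ ⊗≫ X ◁ G ▷ Bᘁ ⊗≫ ((X ⊗ A) ◁ F' ≫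
        evR (X ⊗ A) (Aᘁ ⊗ Xᘁ)) := by
        rw [whisker_exchange]
        monoidal
    _ = _ := by
        rw [h₃]
        monoidal

end Pivotal

/-! ### Symmetric Frobenius algebras and the canonical trace -/

section CanonicalTrace

open ModularTensorCategory

variable {C : Type u} [Category.{v} C] [Abelian C] [Linear ℂ C]
  [MonoidalCategory C] [MonoidalPreadditive C] [MonoidalLinear ℂ C] [BraidedCategory C]
  [RigidCategory C] [ModularTensorCategory C]

lemma ptr_leftUnitor_comp {A : C} (f : A ⟶ A) : ptr ((λ_ A).hom ≫ f) = tr f := by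
  simp only [ptr, tr]
  have h : (ρ_ (𝟙_ C)).inv ≫ 𝟙_ C ◁ η_ A Aᘁ ≫ (α_ _ _ _).inv ≫ (λ_ A).hom ▷ Aᘁ = η_ A Aᘁ := by
    rw [← unitors_inv_equal]
    simp
  rw [comp_whiskerRight, Category.assoc, reassoc_of% h]

/-- The morphism `A ⟶ Aᘁ` obtained from a pairing by means of `coev'` turns `ev'` into the
pairing. -/
lemma whiskerLeft_coev'_ev' {A : C} (κ : A ⊗ A ⟶ 𝟙_ C) :
    A ◁ ((λ_ A).inv ≫ coev' A ▷ A ≫ (α_ Aᘁ A A).hom ≫ Aᘁ ◁ κ ≫ (ρ_ Aᘁ).hom) ≫ ev' A = κ := by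
  calc _ = 𝟙 (A ⊗ A) ⊗≫ A ◁ coev' A ▷ A ⊗≫ ((A ⊗ Aᘁ) ◁ κ ≫ ev' A ▷ 𝟙_ C) ⊗≫ 𝟙 (𝟙_ C) := by
        monoidal
    _ = 𝟙 (A ⊗ A) ⊗≫ (A ◁ coev' A ≫ (α_ _ _ _).inv ≫ ev' A ▷ A) ▷ A ⊗≫ κ := by
        rw [whisker_exchange]
        monoidal
    _ = _ := by
        rw [coev'_ev']
        monoidal

/-- The canonical trace form on an algebra, the partial trace of its product, is symmetric. -/
lemma isSymmetric_of_counit_eq_ptr {A : FrobeniusData C} (hA : A.IsAlgebra)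
    (h : A.counit = ptr A.mul) : A.IsSymmetric := by
  have h₁ : A.mul ≫ A.counit = ptr ((α_ _ _ _).hom ≫ A.X ◁ A.mul ≫ A.mul) := by
    rw [h, comp_ptr, hA.assoc]
  refine hom_ext_ev' ?_
  rw [whiskerLeft_coev'_ev', h₁]
  exact ptr_cyclic A.mul A.mul

/-- In a symmetric Frobenius algebra, the counit after product after coproduct is the canonical
trace form. -/
lemma comul_mul_counit {A : FrobeniusData C} (hA : A.IsFrobenius) (hs : A.IsSymmetric) :
    A.comul ≫ A.mul ≫ A.counit = ptr A.mul := by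
  set Φ : A.X ⟶ A.Xᘁ := (ρ_ A.X).inv ≫ A.X ◁ η_ A.X A.Xᘁ ≫ (α_ A.X A.X A.Xᘁ).inv ≫
      (A.mul ≫ A.counit) ▷ A.Xᘁ ≫ (λ_ A.Xᘁ).hom with hΦ
  have h₁ : A.X ◁ Φ ≫ ev' A.X = A.mul ≫ A.counit := by
    rw [hΦ, hs]
    exact whiskerLeft_coev'_ev' _
  -- The pairing `mul ≫ counit` and the copairing `one ≫ comul` satisfy a zigzag identity.
  have h₂ : (A.one ≫ A.comul) ▷ A.X ≫ (α_ _ _ _).hom ≫ A.X ◁ (A.mul ≫ A.counit) =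
      (λ_ _).hom ≫ (ρ_ _).inv := by
    have := hA.comul_right
    rw [comp_whiskerRight, whiskerLeft_comp, Category.assoc, reassoc_of% this,
      hA.comul_counit, reassoc_of% hA.one_mul]
  have h₃ : (A.one ≫ A.comul) ≫ A.X ◁ Φ = η_ A.X A.Xᘁ := by
    calc _ = 𝟙 (𝟙_ C) ⊗≫ ((A.one ≫ A.comul) ▷ 𝟙_ C ≫ (A.X ⊗ A.X) ◁ η_ A.X A.Xᘁ) ⊗≫
          A.X ◁ (A.mul ≫ A.counit) ▷ A.Xᘁ ⊗≫ 𝟙 (A.X ⊗ A.Xᘁ) := by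
          rw [hΦ]
          monoidal
      _ = 𝟙 (𝟙_ C) ⊗≫ 𝟙_ C ◁ η_ A.X A.Xᘁ ⊗≫ ((A.one ≫ A.comul) ▷ A.X ≫ (α_ _ _ _).hom ≫
          A.X ◁ (A.mul ≫ A.counit)) ▷ A.Xᘁ ⊗≫ 𝟙 (A.X ⊗ A.Xᘁ) := by
          rw [← whisker_exchange]
          monoidal
      _ = _ := by
          rw [h₂]
          monoidal
  have h₄ : A.comul = (ρ_ A.X).inv ≫ A.X ◁ (A.one ≫ A.comul) ≫ (α_ _ _ _).inv ≫
      A.mul ▷ A.X := by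
    rw [whiskerLeft_comp, Category.assoc, hA.comul_left, reassoc_of% hA.mul_one,
      Iso.inv_hom_id_assoc]
  rw [ptr, ← h₃, whiskerLeft_comp]
  conv_lhs => rw [h₄]
  simp only [Category.assoc]
  rw [← h₁]
  simp only [associator_inv_naturality_right_assoc, whisker_exchange_assoc]

/-- Product after coproduct, closed by the unit and counit, is the quantum dimension. This decides
which scalars vanish in a special symmetric Frobenius algebra. -/
lemma one_comul_mul_counit {A : FrobeniusData C} (hA : A.IsFrobenius) (hs : A.IsSymmetric) :
    A.one ≫ A.comul ≫ A.mul ≫ A.counit = qdim A.X := by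
  rw [comul_mul_counit hA hs, comp_ptr, hA.one_mul, ← tr_id, ← ptr_leftUnitor_comp,
    Category.comp_id]

variable {S : Type u₁} [Category.{v₁} S] [MonoidalLeftAction C S] {F : S ⥤ C} [F.LeftLinear C]
  {m : S}

/-- The canonical trace form on the internal endomorphism object of `m`. -/
def traceForm (h : InnerHom F m) : F.obj m ⟶ 𝟙_ C := ptr (h.comp F m)

/-- The canonical trace form computes the trace of `F p` for an endomorphism `p` of `m`. -/
lemma unit_map_traceForm (h : InnerHom F m) (p : m ⟶ m) :
    h.unit ≫ F.map p ≫ traceForm h = tr (F.map p) := by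
  rw [traceForm, comp_ptr, comp_ptr, h.comp_naturality, h.unit_comp_assoc, ptr_leftUnitor_comp]

end CanonicalTrace

/-! ### Universality of the canonical trace form -/

section Universality

open ModularTensorCategory MonoidalLeftAction

/-- The unit of an internal Hom functor is a universal morphism `𝟙_ C ⟶ F m`. -/
lemma InnerHom.bijective_unit_comp_map {C : Type u} [Category.{v} C] [MonoidalCategory C]
    {S : Type u₁} [Category.{v₁} S] [MonoidalLeftAction C S] {F : S ⥤ C} [F.LeftLinear C] {m : S}
    (h : InnerHom F m) (s : S) : Function.Bijective fun f : m ⟶ s => h.unit ≫ F.map f := by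
  refine Function.bijective_iff_has_inverse.2
    ⟨fun x => (λₗ m).inv ≫ x ⊵ₗ m ≫ h.ev s, fun f => ?_, fun x => ?_⟩
  · simp only [comp_actionHomLeft, Category.assoc]
    rw [h.ev_naturality, h.unit_ev_assoc, Iso.inv_hom_id_assoc]
  · have h₁ : F.map (λₗ m).inv = (λ_ _).inv ≫ (str F (𝟙_ C) m).hom := by
      rw [← str_inv_unit, Category.assoc, Iso.inv_hom_id, Category.comp_id]
    have h₂ := h.comp_unit s
    rw [InnerHom.comp] at h₂
    simp only [F.map_comp]
    rw [h₁, Category.assoc, ← str_naturality_left_assoc, leftUnitor_inv_naturality_assoc,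
      whisker_exchange_assoc, h₂, rightUnitor_naturality, unitors_inv_equal,
      Iso.inv_hom_id_assoc]

/-- A bilinear pairing with values in a line that separates the points of its first argument
bounds the dimension of that argument. -/
lemma finrank_le_of_injective {V W E : Type*} [AddCommGroup V] [Module ℂ V] [AddCommGroup W]
    [Module ℂ W] [AddCommGroup E] [Module ℂ E] [Module.Finite ℂ W] [Module.Finite ℂ E]
    (hE : Module.finrank ℂ E = 1) (B : V →ₗ[ℂ] W →ₗ[ℂ] E) (hB : Function.Injective B) :
    Module.finrank ℂ V ≤ Module.finrank ℂ W := by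
  have h := LinearMap.finrank_le_finrank_of_injective hB
  rwa [Module.finrank_linearMap, hE, mul_one] at h

variable {C : Type u} [Category.{v} C] [Abelian C] [Linear ℂ C]
  [MonoidalCategory C] [MonoidalPreadditive C] [MonoidalLinear ℂ C] [BraidedCategory C]
  [RigidCategory C] [ModularTensorCategory C]

lemma finrank_end_unit : Module.finrank ℂ (𝟙_ C ⟶ 𝟙_ C) = 1 := by
  have := ModularTensorCategory.finitelySemisimple (C := C)
  have := FinitelySemisimple.finite_hom (𝟙_ C) (𝟙_ C)
  have := ModularTensorCategory.simple_unit (C := C)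
  exact finrank_endomorphism_simple_eq_one ℂ (𝟙_ C)

variable (hdim : ∀ X : C, ¬ IsZero X → qdim X ≠ 0)
  {S : Type u₁} [Category.{v₁} S] [Abelian S] [Linear ℂ S] [FinitelySemisimple S]
  [MonoidalLeftAction C S] {F : S ⥤ C} [F.LeftLinear C] {m : S} (h : InnerHom F m)

include hdim

/-- The trace pairing between `f : s ⟶ m` and morphisms `m ⟶ s` is nondegenerate: for a generalized
inverse `t` of `f`, the trace of the idempotent `F (t ≫ f)` is a quantum dimension. -/
lemma exists_traceForm_ne_zero {s : S} {f : s ⟶ m} (hf : f ≠ 0) :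
    ∃ t : m ⟶ s, f ≫ t ≫ f = f ∧ h.unit ≫ F.map (t ≫ f) ≫ traceForm h ≠ 0 := by
  obtain ⟨t, ht⟩ := exists_regular FinitelySemisimple.projective f
  refine ⟨t, ht, ?_⟩
  have hp : (t ≫ f) ≫ (t ≫ f) = t ≫ f := by rw [Category.assoc, ht]
  obtain ⟨Z, i, r, hir, hri⟩ := IsIdempotentComplete.idempotents_split m (t ≫ f) hp
  rw [unit_map_traceForm, ← hri, F.map_comp, tr_comp_comm, ← F.map_comp, hir, F.map_id, tr_id]
  refine hdim _ fun hZ => hf ?_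
  have hr : r = 0 := (h.bijective_unit_comp_map Z).1 (hZ.eq_of_tgt _ _)
  rw [← ht, ← hri, hr, zero_comp, comp_zero]

/-- The canonical trace form is a universal morphism `F m ⟶ 𝟙_ C`. Injectivity is nondegeneracy of
the trace pairing; surjectivity follows by comparison of the dimensions of `s ⟶ m`, `m ⟶ s` and
`F s ⟶ 𝟙_ C`. -/
lemma bijective_map_comp_traceForm [BilinearAction C S] [F.Additive] (s : S) :
    Function.Bijective fun f : s ⟶ m => F.map f ≫ traceForm h := by
  have hC := ModularTensorCategory.finitelySemisimple (C := C)
  have := FinitelySemisimple.finite_hom (C := S)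
  have := FinitelySemisimple.finite_hom (C := C)
  let T : (s ⟶ m) →ₗ[ℂ] (F.obj s ⟶ 𝟙_ C) :=
    { toFun := fun f => F.map f ≫ traceForm h
      map_add' := fun f g => by rw [F.map_add, Preadditive.add_comp]
      map_smul' := fun z f => by
        rw [map_smul_of_leftLinear, Linear.smul_comp, RingHom.id_apply] }
  let B (s' : S) : (m ⟶ s') →ₗ[ℂ] (F.obj s' ⟶ 𝟙_ C) →ₗ[ℂ] (𝟙_ C ⟶ 𝟙_ C) :=
    LinearMap.mk₂ ℂ (fun g x => h.unit ≫ F.map g ≫ x)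
      (fun g g' x => by rw [F.map_add, Preadditive.add_comp, Preadditive.comp_add])
      (fun z g x => by rw [map_smul_of_leftLinear, Linear.smul_comp, Linear.comp_smul])
      (fun g x x' => by rw [Preadditive.comp_add, Preadditive.comp_add])
      (fun z g x => by rw [Linear.comp_smul, Linear.comp_smul])
  have hT : Function.Injective T := by
    rw [injective_iff_map_eq_zero]
    intro f hf
    by_contra hne
    obtain ⟨t, -, ht⟩ := exists_traceForm_ne_zero hdim h hne
    refine ht ?_
    rw [F.map_comp, Category.assoc]
    change h.unit ≫ F.map t ≫ T f = 0
    rw [hf, comp_zero, comp_zero]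
  have h₁ : Module.finrank ℂ (F.obj s ⟶ 𝟙_ C) ≤ Module.finrank ℂ (m ⟶ s) := by
    refine finrank_le_of_injective finrank_end_unit (B s).flip ?_
    rw [injective_iff_map_eq_zero]
    intro x hx
    obtain ⟨t, ht⟩ := exists_regular FinitelySemisimple.projective x
    obtain ⟨g, hg⟩ := (h.bijective_unit_comp_map s).2 t
    have h₃ : h.unit ≫ F.map g ≫ x = 0 := LinearMap.congr_fun hx g
    simp only at hg
    rw [← ht, ← hg, Category.assoc, h₃, comp_zero]
  have h₂ : Module.finrank ℂ (m ⟶ s) ≤ Module.finrank ℂ (s ⟶ m) := by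
    refine finrank_le_of_injective finrank_end_unit ((B s).compl₂ T) ?_
    rw [injective_iff_map_eq_zero]
    intro g hg
    by_contra hne
    obtain ⟨t, ht⟩ := exists_regular FinitelySemisimple.projective g
    have hp : g ≫ t ≠ 0 := fun h₀ => hne (by rw [← ht, reassoc_of% h₀, zero_comp])
    obtain ⟨t', -, ht'⟩ := exists_traceForm_ne_zero hdim h hp
    refine ht' ?_
    have h₃ : h.unit ≫ F.map g ≫ F.map (t ≫ t') ≫ traceForm h = 0 :=
      LinearMap.congr_fun hg (t ≫ t')
    rw [unit_map_traceForm, F.map_comp, tr_comp_comm, ← F.map_comp, ← unit_map_traceForm h]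
    simpa only [F.map_comp, Category.assoc] using h₃
  have h₄ := LinearMap.finrank_le_finrank_of_injective hT
  exact ⟨hT, (LinearMap.injective_iff_surjective_of_finrank_eq_finrank
    (le_antisymm h₄ (h₁.trans h₂))).1 hT⟩

end Universality

/-! ### Special symmetric Frobenius algebras from Wilson lines -/

section Wilson

open ModularTensorCategory MonoidalLeftAction

/-- Coevaluation and evaluation combine to a natural endomorphism of the identity functor. -/
lemma central_naturality {C : Type u} [Category.{v} C] [MonoidalCategory C]
    {S : Type u₁} [Category.{v₁} S] [MonoidalLeftAction C S] {F : S ⥤ C} [F.LeftLinear C] {m : S}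
    (h : InnerHom F m) (k : InnerCohom F m) {s s' : S} (f : s ⟶ s') :
    f ≫ h.central k s' = h.central k s ≫ f := by
  rw [InnerHom.central, ← k.coev_naturality_assoc, h.ev_naturality, InnerHom.central,
    Category.assoc]

/-- The natural endomorphism given by coevaluation and evaluation is compatible with the action. -/
lemma central_action {C : Type u} [Category.{v} C] [MonoidalCategory C]
    {S : Type u₁} [Category.{v₁} S] [MonoidalLeftAction C S] {F : S ⥤ C} [F.LeftLinear C] {m : S}
    (h : InnerHom F m) (k : InnerCohom F m) (c : C) (s : S) :
    h.central k (c ⊙ₗ s) = c ⊴ₗ h.central k s := by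
  rw [InnerHom.central, InnerHom.central, actionHomRight_comp, ← k.coev_action, Category.assoc,
    Category.assoc, ← h.ev_action, inv_hom_actionHomLeft_assoc]

/-- Product after coproduct is the image of the central endomorphism. -/
lemma cocomp_comp {C : Type u} [Category.{v} C] [MonoidalCategory C]
    {S : Type u₁} [Category.{v₁} S] [MonoidalLeftAction C S] {F : S ⥤ C} [F.LeftLinear C] {m : S}
    (h : InnerHom F m) (k : InnerCohom F m) (s : S) :
    k.cocomp s ≫ h.comp F s = F.map (h.central k s) := by
  rw [InnerCohom.cocomp, InnerHom.comp, InnerHom.central, F.map_comp, Category.assoc,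
    Iso.inv_hom_id_assoc]

/-- The internal endomorphism object of `m` is non-zero as soon as the module functor is: every
`F s` is a retract of `F s ⊗ F m`. -/
lemma not_isZero_map_of_not_isZero_map {C : Type u} [Category.{v} C] [Preadditive C]
    [MonoidalCategory C] [MonoidalPreadditive C] {S : Type u₁} [Category.{v₁} S]
    [MonoidalLeftAction C S] {F : S ⥤ C} [F.LeftLinear C] {m s : S} (h : InnerHom F m)
    (hs : ¬ IsZero (F.obj s)) : ¬ IsZero (F.obj m) := fun hm => hs <| by
  have h₁ := h.comp_unit s
  have h₂ : F.obj s ◁ h.unit = 0 := by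
    rw [hm.eq_of_tgt h.unit 0, MonoidalPreadditive.whiskerLeft_zero]
  rw [h₂, zero_comp] at h₁
  rw [IsZero.iff_id_eq_zero, ← (ρ_ (F.obj s)).inv_hom_id, ← h₁, comp_zero]

lemma not_isZero_of_isNonzero {C : Type u} [Category.{v} C] [Preadditive C]
    [MonoidalCategory C] [MonoidalPreadditive C] {S : Type u₁} [Category.{v₁} S] [Preadditive S]
    [MonoidalLeftAction C S] {M : ModuleFunctor C S C} (hM : M.IsNonzero) {m : S}
    (h : InnerHom M.functor m) : ¬ IsZero (M.functor.obj m) ∧ ¬ IsZero m := by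
  obtain ⟨s, hs⟩ := hM
  have h₁ := not_isZero_map_of_not_isZero_map h hs
  exact ⟨h₁, fun hm => h₁ (M.functor.map_isZero hm)⟩

variable {C : Type u} [Category.{v} C] [Abelian C] [Linear ℂ C]
  [MonoidalCategory C] {S : Type u₁} [Category.{v₁} S] [Abelian S] [Linear ℂ S]
  [MonoidalLeftAction C S] [BilinearAction C S] {F : S ⥤ C} [F.LeftLinear C] {m : S}

/-- The central endomorphism of the identity functor given by coevaluation and evaluation is a
module transformation, hence a scalar if the surface defect is special. -/
lemma exists_central_eq_smul (hS : IsSpecialDefect C S) (h : InnerHom F m) (k : InnerCohom F m)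
    (hm : ¬ IsZero m) : ∃ b : ℂ, ∀ s, h.central k s = b • 𝟙 s := by
  obtain ⟨e⟩ := hS
  let z : idEnd C S := ⟨{ app := h.central k, naturality := fun _ _ f => central_naturality h k f },
    fun c s => (Category.id_comp _).trans
      ((central_action h k c s).trans (Category.comp_id _).symm)⟩
  let o : idEnd C S := ⟨𝟙 _, fun c s => by
    change 𝟙 _ ≫ 𝟙 _ = c ⊴ₗ 𝟙 s ≫ 𝟙 _
    simp⟩
  have ho : o ≠ 0 := fun h₀ => hm ((IsZero.iff_id_eq_zero m).2
    (congrArg (fun t : idEnd C S => (t : 𝟭 S ⟶ 𝟭 S).app m) h₀))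
  have he : e o ≠ 0 := fun h₀ => ho (e.map_eq_zero_iff.1 h₀)
  have hz : z = (e z / e o) • o := e.injective (by rw [map_smul, smul_eq_mul, div_mul_cancel₀ _ he])
  exact ⟨_, fun s => congrArg (fun t : idEnd C S => (t : 𝟭 S ⟶ 𝟭 S).app s) hz⟩

end Wilson

section Special

open ModularTensorCategory MonoidalLeftAction

variable {C : Type u} [Category.{v} C] [Abelian C] [Linear ℂ C]
  [MonoidalCategory C] [MonoidalPreadditive C] [MonoidalLinear ℂ C] [BraidedCategory C]
  [RigidCategory C] [ModularTensorCategory C]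

/-- The endomorphisms of the tensor unit are scalars. -/
lemma exists_smul_id (f : 𝟙_ C ⟶ 𝟙_ C) : ∃ b : ℂ, f = b • 𝟙 (𝟙_ C) := by
  have := ModularTensorCategory.finitelySemisimple (C := C)
  have := ModularTensorCategory.simple_unit (C := C)
  have := FinitelySemisimple.finite_hom (𝟙_ C) (𝟙_ C)
  obtain ⟨b, hb⟩ := endomorphism_simple_eq_smul_id ℂ f
  exact ⟨b, hb.symm⟩

variable {S : Type u₁} [Category.{v₁} S] [Abelian S] [Linear ℂ S]
  [MonoidalLeftAction C S] [BilinearAction C S] {F : S ⥤ C} [F.LeftLinear C] {m : S}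

/-- A symmetric internal endomorphism algebra of non-zero dimension on which product after
coproduct is a scalar is special. -/
lemma isSpecial_of_central_eq_smul (h : InnerHom F m) (k : InnerCohom F m)
    (hs : (innerEnd h k).IsSymmetric) (hq : qdim (F.obj m) ≠ 0) {b : ℂ}
    (hb : h.central k m = b • 𝟙 m) : (innerEnd h k).IsSpecial := by
  have h₁ : (innerEnd h k).comul ≫ (innerEnd h k).mul = b • 𝟙 _ := by
    refine (cocomp_comp h k m).trans ?_
    rw [hb, map_smul_of_leftLinear, F.map_id]
    rfl
  have h₂ := one_comul_mul_counit (innerEnd_isFrobenius h k) hs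
  rw [reassoc_of% h₁, Linear.smul_comp, Linear.comp_smul, Category.id_comp] at h₂
  obtain ⟨b', hb'⟩ := exists_smul_id ((innerEnd h k).one ≫ (innerEnd h k).counit)
  rw [hb'] at h₂
  refine ⟨⟨b, ?_, h₁⟩, ⟨b', ?_, hb'⟩⟩
  · rintro rfl
    exact hq (by rw [← zero_smul ℂ, h₂]; rfl)
  · rintro rfl
    rw [zero_smul, smul_zero] at h₂
    exact hq h₂.symm

variable [FinitelySemisimple S]

/-- If the counit is the canonical trace form, then the central endomorphism is the identity of `m`:
its composition with the counit is the counit again, and the counit is universal. -/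
lemma central_eq_id [F.Additive] (hdim : ∀ X : C, ¬ IsZero X → qdim X ≠ 0) (h : InnerHom F m)
    (k : InnerCohom F m) (hk : k.counit = traceForm h) : h.central k m = 𝟙 m := by
  have hs : (innerEnd h k).IsSymmetric :=
    isSymmetric_of_counit_eq_ptr (innerEnd_isFrobenius h k).toIsAlgebra hk
  have h₁ : k.cocomp m ≫ h.comp F m ≫ k.counit = ptr (h.comp F m) :=
    comul_mul_counit (innerEnd_isFrobenius h k) hs
  refine (bijective_map_comp_traceForm hdim h m).1 ?_
  simp only
  rw [← cocomp_comp, ← hk, Category.assoc, h₁, F.map_id, Category.id_comp, hk]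
  rfl

end Special

/-! ### Morita equivalence of internal endomorphism algebras -/

section Morita

open MonoidalLeftAction

section Bimodules

variable {C : Type u} [Category.{v} C] [MonoidalCategory C]
  {S : Type u₁} [Category.{v₁} S] [MonoidalLeftAction C S]
  {F : S ⥤ C} [F.LeftLinear C] {m : S} {G : S ⥤ C} [G.LeftLinear C] {n : S}

/-- The internal endomorphism algebra of `m`. -/
def innerMon (h : InnerHom F m) : Mon C where
  X := F.obj m
  mon :=
    { one := h.unit
      mul := h.comp F m
      one_mul := h.unit_comp F
      mul_one := h.comp_unit m
      mul_assoc := h.comp_assoc F h F m }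

/-- The internal Hom object `G m = Hom(n, m)` as a bimodule over the internal endomorphism algebras
of `m` and `n`. -/
def innerBimod (h : InnerHom F m) (k : InnerHom G n) : Bimod (innerMon h) (innerMon k) where
  X := G.obj m
  actLeft := h.comp G m
  one_actLeft := h.unit_comp G
  left_assoc := h.comp_assoc F h G m
  actRight := k.comp G m
  actRight_one := k.comp_unit m
  right_assoc := by
    have := k.comp_assoc G k G m
    exact ((Iso.inv_comp_eq _).2 this).symm
  middle_assoc := h.comp_assoc G k G m

variable (h : InnerHom F m) (k : InnerHom G n)

/-- If the evaluation `G m ⊙ n ⟶ m` has a section `σ`, then the composition of internal Homs is a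
coequalizer, split by means of `σ`. -/
lemma exists_splitting {σ : m ⟶ G.obj m ⊙ₗ n} (hσ : σ ≫ k.ev m = 𝟙 m) :
    ∃ (s : F.obj m ⟶ G.obj m ⊗ F.obj n) (t : G.obj m ⊗ F.obj n ⟶ (G.obj m ⊗ G.obj n) ⊗ F.obj n),
      s ≫ k.comp F m = 𝟙 _ ∧ t ≫ k.comp G m ▷ F.obj n = 𝟙 _ ∧
        k.comp F m ≫ s = t ≫ (α_ _ _ _).hom ≫ G.obj m ◁ k.comp F n := by
  refine ⟨F.map σ ≫ (str F (G.obj m) n).inv, (G.map σ ≫ (str G (G.obj m) n).inv) ▷ F.obj n,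
    ?_, ?_, ?_⟩
  · rw [InnerHom.comp, Category.assoc, Iso.inv_hom_id_assoc, ← F.map_comp, hσ, F.map_id]
  · rw [InnerHom.comp, ← comp_whiskerRight, Category.assoc, Iso.inv_hom_id_assoc, ← G.map_comp, hσ,
      G.map_id, id_whiskerRight]
  · have h₁ : k.ev m ≫ σ = G.map σ ⊵ₗ n ≫ (str G (G.obj m) n).inv ⊵ₗ n ≫
        (αₗ (G.obj m) (G.obj n) n).hom ≫ G.obj m ⊴ₗ k.ev n := by
      rw [← k.ev_naturality, ← k.ev_action, inv_hom_actionHomLeft_assoc]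
    simp only [InnerHom.comp, Category.assoc, comp_whiskerRight, whiskerLeft_comp]
    rw [← F.map_comp_assoc, h₁]
    simp only [F.map_comp, Category.assoc]
    rw [← str_naturality_left_assoc, ← str_naturality_left_assoc, str_assoc_assoc,
      str_inv_naturality_right, Iso.hom_inv_id_assoc]

variable {C : Type u} [Category.{v} C] [Abelian C] [MonoidalCategory C] [RigidCategory C]
  {S : Type u₁} [Category.{v₁} S] [MonoidalLeftAction C S]
  {F : S ⥤ C} [F.LeftLinear C] {m : S} {G : S ⥤ C} [G.LeftLinear C] {n : S}

/-- The composition of internal Homs identifies `Hom(n, m) ⊗ Hom(m, n)`, with the tensor product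
taken over the endomorphism algebra of `n`, with the endomorphism algebra of `m`. -/
lemma nonempty_tensorBimod_iso (h : InnerHom F m) (k : InnerHom G n) {σ : m ⟶ G.obj m ⊙ₗ n}
    (hσ : σ ≫ k.ev m = 𝟙 m) :
    Nonempty ((innerBimod h k).tensorBimod (innerBimod k h) ≅ Bimod.regular (innerMon h)) := by
  obtain ⟨s, t, hs, ht, hst⟩ := exists_splitting (F := F) k hσ
  let f : (G.obj m ⊗ G.obj n) ⊗ F.obj n ⟶ G.obj m ⊗ F.obj n := k.comp G m ▷ F.obj n
  let g : (G.obj m ⊗ G.obj n) ⊗ F.obj n ⟶ G.obj m ⊗ F.obj n :=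
    (α_ _ _ _).hom ≫ G.obj m ◁ k.comp F n
  have hfg : f ≫ k.comp F m = g ≫ k.comp F m := by
    rw [Category.assoc]
    exact k.comp_assoc G k F m
  let d : coequalizer f g ⟶ F.obj m := coequalizer.desc _ hfg
  have hd : coequalizer.π f g ≫ d = k.comp F m := coequalizer.π_desc _ _
  let e : coequalizer f g ≅ F.obj m :=
    { hom := d
      inv := s ≫ coequalizer.π f g
      hom_inv_id := by
        refine coequalizer.hom_ext ?_
        rw [reassoc_of% hd, reassoc_of% hst, Category.comp_id]
        have := coequalizer.condition f g
        simp only [g, Category.assoc] at this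
        rw [← this, reassoc_of% ht]
      inv_hom_id := by rw [Category.assoc, hd, hs] }
  refine ⟨Bimod.isoOfIso e ?_ ?_⟩
  · refine (cancel_epi ((tensorLeft (F.obj m)).map (coequalizer.π f g))).1 ?_
    let a : F.obj m ⊗ coequalizer f g ⟶ coequalizer f g :=
      Bimod.TensorBimod.actLeft (innerBimod h k) (innerBimod k h)
    have h₁ : F.obj m ◁ coequalizer.π f g ≫ a =
        (α_ _ _ _).inv ≫ h.comp G m ▷ F.obj n ≫ coequalizer.π f g :=
      Bimod.TensorBimod.whiskerLeft_π_actLeft (innerBimod h k) (innerBimod k h)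
    have h₂ : F.obj m ◁ coequalizer.π f g ≫ a ≫ d =
        F.obj m ◁ coequalizer.π f g ≫ F.obj m ◁ d ≫ h.comp F m := by
      rw [reassoc_of% h₁, hd, ← whiskerLeft_comp_assoc, hd, Iso.inv_comp_eq]
      exact h.comp_assoc G k F m
    exact h₂
  · refine (cancel_epi ((tensorRight (F.obj m)).map (coequalizer.π f g))).1 ?_
    let a : coequalizer f g ⊗ F.obj m ⟶ coequalizer f g :=
      Bimod.TensorBimod.actRight (innerBimod h k) (innerBimod k h)
    have h₁ : coequalizer.π f g ▷ F.obj m ≫ a =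
        (α_ _ _ _).hom ≫ G.obj m ◁ h.comp F n ≫ coequalizer.π f g :=
      Bimod.TensorBimod.π_tensor_id_actRight (innerBimod h k) (innerBimod k h)
    have h₂ : coequalizer.π f g ▷ F.obj m ≫ a ≫ d =
        coequalizer.π f g ▷ F.obj m ≫ d ▷ F.obj m ≫ h.comp F m := by
      rw [reassoc_of% h₁, hd, ← comp_whiskerRight_assoc, hd]
      exact (k.comp_assoc F h F m).symm
    exact h₂

lemma moritaEquivalent_innerMon (h : InnerHom F m) (k : InnerHom G n)
    (hσ : ∃ σ, σ ≫ k.ev m = 𝟙 m) (hτ : ∃ τ, τ ≫ h.ev n = 𝟙 n) :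
    MoritaEquivalent (innerMon h) (innerMon k) := by
  obtain ⟨σ, hσ⟩ := hσ
  obtain ⟨τ, hτ⟩ := hτ
  exact ⟨innerBimod h k, innerBimod k h, nonempty_tensorBimod_iso h k hσ,
    nonempty_tensorBimod_iso k h hτ⟩

end Bimodules

lemma toMon_wilsonAlgebra {C : Type u} [Category.{v} C] [Preadditive C] [MonoidalCategory C]
    {S : Type u₁} [Category.{v₁} S] [Preadditive S] [MonoidalLeftAction C S]
    {M : ModuleFunctor C S C} {Mbar : ModuleFunctor C C S} (l : ModuleAdjunction C Mbar M)
    (r : ModuleAdjunction C M Mbar) (h : (wilsonAlgebra M Mbar l r).IsAlgebra) :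
    (wilsonAlgebra M Mbar l r).toMon h = innerMon l.innerHom := by
  have key : ∀ (A : FrobeniusData C) (_ : A = innerEnd l.innerHom r.innerCohom) (h : A.IsAlgebra),
      A.toMon h = innerMon l.innerHom := by
    rintro _ rfl _
    rfl
  exact key _ (wilsonAlgebra_eq l r) h

/-- For a nondegenerate Wilson line the evaluation is a split epimorphism: `M` annihilates the
idempotent which projects to a complement of its image. -/
lemma exists_section_ev_of_isNondegenerate {C : Type u} [Category.{v} C] [Abelian C]
    [MonoidalCategory C] {S : Type u₁} [Category.{v₁} S] [Abelian S] [Linear ℂ S]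
    [FinitelySemisimple S] [MonoidalLeftAction C S] {M : ModuleFunctor C S C}
    (hM : M.IsNondegenerate) {m : S} (h : InnerHom M.functor m) (s : S) :
    ∃ σ, σ ≫ h.ev s = 𝟙 s := by
  obtain ⟨t, ht⟩ := exists_regular FinitelySemisimple.projective (h.ev s)
  refine ⟨t, ?_⟩
  have h₀ : h.ev s ≫ (𝟙 s - t ≫ h.ev s) = 0 := by
    rw [Preadditive.comp_sub, Category.comp_id, ht, sub_self]
  have hq : (𝟙 s - t ≫ h.ev s) ≫ (𝟙 s - t ≫ h.ev s) = 𝟙 s - t ≫ h.ev s := by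
    rw [Preadditive.sub_comp, Category.assoc, h₀, comp_zero, sub_zero, Category.id_comp]
  obtain ⟨Z, i, r, hir, hri⟩ := IsIdempotentComplete.idempotents_split s _ hq
  have h₁ : M.functor.map (𝟙 s - t ≫ h.ev s) = 0 := by
    rw [← cancel_epi (ρ_ (M.functor.obj s)).hom, ← h.comp_unit s, InnerHom.comp]
    simp only [Category.assoc]
    rw [← M.functor.map_comp, h₀, M.functor.map_zero]
    simp only [comp_zero]
  have hZ : IsZero Z := by
    by_contra hZ
    -- The identity of `M Z` factors through `M (𝟙 - t ≫ ev)`, which is zero.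
    refine hM Z hZ ((IsZero.iff_id_eq_zero _).2 ?_)
    have h₂ : 𝟙 Z = i ≫ (r ≫ i) ≫ r := by rw [Category.assoc, hir, Category.comp_id, hir]
    rw [← M.functor.map_id, h₂, hri, M.functor.map_comp, M.functor.map_comp, h₁, zero_comp,
      comp_zero]
  rw [hZ.eq_of_tgt r 0, zero_comp] at hri
  exact (sub_eq_zero.1 hri.symm).symm

variable {C : Type u} [Category.{v} C] [Abelian C] [Linear ℂ C]
  [MonoidalCategory C] [MonoidalPreadditive C] [MonoidalLinear ℂ C]
  [BraidedCategory C] [RigidCategory C] [ModularTensorCategory C]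
  {S : Type u₁} [Category.{v₁} S] [Abelian S] [Linear ℂ S] [FinitelySemisimple S]
  [MonoidalLeftAction C S] [BilinearAction C S]

/-- For every left adjoint of a Wilson line there is an adjunction on the other side whose counit is
the canonical trace form. -/
lemma exists_adjunction_traceForm (hdim : ∀ X : C, ¬ IsZero X → qdim X ≠ 0)
    {M : ModuleFunctor C S C} {Mbar : ModuleFunctor C C S} (l : ModuleAdjunction C Mbar M) :
    ∃ r : ModuleAdjunction C M Mbar, r.innerCohom.counit = traceForm l.innerHom :=
  exists_rightAdjoint_of_universal M Mbar (traceForm l.innerHom)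
    (bijective_map_comp_traceForm hdim l.innerHom)

/-- For a non-zero Wilson line of a special surface defect the evaluation is a split epimorphism:
the coevaluation is a section of it up to a non-zero scalar. -/
lemma exists_section_ev_of_isSpecialDefect (hdim : ∀ X : C, ¬ IsZero X → qdim X ≠ 0)
    (hS : IsSpecialDefect C S) {M : ModuleFunctor C S C} (hM : M.IsNonzero)
    {Mbar : ModuleFunctor C C S} (l : ModuleAdjunction C Mbar M) (s : S) :
    ∃ σ, σ ≫ l.innerHom.ev s = 𝟙 s := by
  obtain ⟨r, hr⟩ := exists_adjunction_traceForm hdim l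
  have hm := (not_isZero_of_isNonzero hM l.innerHom).2
  obtain ⟨b, hb⟩ := exists_central_eq_smul hS l.innerHom r.innerCohom hm
  have hb₀ : b ≠ 0 := by
    rintro rfl
    refine hm ((IsZero.iff_id_eq_zero _).2 ?_)
    rw [← central_eq_id hdim l.innerHom r.innerCohom hr, hb, zero_smul]
  refine ⟨b⁻¹ • r.innerCohom.coev s, ?_⟩
  have h := hb s
  rw [InnerHom.central] at h
  rw [Linear.smul_comp, h, smul_smul, inv_mul_cancel₀ hb₀, one_smul]

end Morita

end SurfaceDefect

open SurfaceDefect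
theorem mainTheorem1
    {C : Type u} [Category.{v} C] [Abelian C] [Linear ℂ C] [MonoidalCategory C]
    [MonoidalPreadditive C] [MonoidalLinear ℂ C] [BraidedCategory C] [RigidCategory C]
    [ModularTensorCategory C]
    (hdim : ∀ X : C, ¬ IsZero X → qdim X ≠ 0)
    {S : Type u₁} [Category.{v₁} S] [Abelian S] [Linear ℂ S] [FinitelySemisimple S]
    [MonoidalLeftAction C S] [BilinearAction C S] :
    (∃ M : ModuleFunctor C S C, M.IsNondegenerate) ∧
    (∀ M : ModuleFunctor C S C, ∃ Mbar : ModuleFunctor C C S,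
      Nonempty (ModuleAdjunction C Mbar M) ∧ Nonempty (ModuleAdjunction C M Mbar)) ∧
    (∀ (M : ModuleFunctor C S C) (Mbar : ModuleFunctor C C S)
      (l : ModuleAdjunction C Mbar M) (r : ModuleAdjunction C M Mbar),
      (wilsonAlgebra M Mbar l r).IsFrobenius) ∧
    (∀ (M : ModuleFunctor C S C), M.IsNonzero → ∀ (Mbar : ModuleFunctor C C S)
      (l : ModuleAdjunction C Mbar M), ∃ r : ModuleAdjunction C M Mbar,
      (wilsonAlgebra M Mbar l r).IsSymmetric ∧ (wilsonAlgebra M Mbar l r).IsSpecial) ∧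
    (IsSpecialDefect C S → ∀ (M : ModuleFunctor C S C), M.IsNonzero →
      ∀ (Mbar : ModuleFunctor C C S) (l : ModuleAdjunction C Mbar M) (r : ModuleAdjunction C M Mbar),
      (wilsonAlgebra M Mbar l r).IsSymmetric → (wilsonAlgebra M Mbar l r).IsSpecial) ∧
    (∀ (M M' : ModuleFunctor C S C),
      (IsSpecialDefect C S ∧ M.IsNonzero ∧ M'.IsNonzero) ∨
        (M.IsNondegenerate ∧ M'.IsNondegenerate) →
      ∀ (Mbar Mbar' : ModuleFunctor C C S)
        (l : ModuleAdjunction C Mbar M) (r : ModuleAdjunction C M Mbar)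
        (l' : ModuleAdjunction C Mbar' M') (r' : ModuleAdjunction C M' Mbar')
        (h : (wilsonAlgebra M Mbar l r).IsAlgebra)
        (h' : (wilsonAlgebra M' Mbar' l' r').IsAlgebra),
      MoritaEquivalent ((wilsonAlgebra M Mbar l r).toMon h)
        ((wilsonAlgebra M' Mbar' l' r').toMon h')) := by
  have hC := ModularTensorCategory.finitelySemisimple (C := C)
  refine ⟨exists_nondegenerate, fun M => ?_, fun M Mbar l r => ?_, fun M hM Mbar l => ?_,
    fun hS M hM Mbar l r hs => ?_, fun M M' H Mbar Mbar' l r l' r' h h' => ?_⟩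
  · obtain ⟨m, u, hu⟩ := exists_universal_of_moduleFunctor M
    let l := leftAdjointOfUniversal M (actOn_additive m) u hu
    obtain ⟨r, -⟩ := exists_adjunction_traceForm hdim l
    exact ⟨_, ⟨l⟩, ⟨r⟩⟩
  · rw [wilsonAlgebra_eq]
    exact innerEnd_isFrobenius _ _
  · obtain ⟨r, hr⟩ := exists_adjunction_traceForm hdim l
    have hs : (innerEnd l.innerHom r.innerCohom).IsSymmetric :=
      isSymmetric_of_counit_eq_ptr (innerEnd_isFrobenius _ _).toIsAlgebra hr
    refine ⟨r, ?_⟩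
    rw [wilsonAlgebra_eq]
    refine ⟨hs, isSpecial_of_central_eq_smul _ _ hs
      (hdim _ (not_isZero_of_isNonzero hM l.innerHom).1) (b := 1) ?_⟩
    rw [one_smul, central_eq_id hdim _ _ hr]
  · rw [wilsonAlgebra_eq] at hs ⊢
    obtain ⟨hA, hm⟩ := not_isZero_of_isNonzero hM l.innerHom
    obtain ⟨b, hb⟩ := exists_central_eq_smul hS l.innerHom r.innerCohom hm
    exact isSpecial_of_central_eq_smul _ _ hs (hdim _ hA) (hb _)
  · rw [toMon_wilsonAlgebra, toMon_wilsonAlgebra]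
    obtain ⟨hS, hM, hM'⟩ | ⟨hM, hM'⟩ := H
    · exact moritaEquivalent_innerMon _ _ (exists_section_ev_of_isSpecialDefect hdim hS hM' l' _)
        (exists_section_ev_of_isSpecialDefect hdim hS hM l _)
    · exact moritaEquivalent_innerMon _ _ (exists_section_ev_of_isNondegenerate hM' _ _)
        (exists_section_ev_of_isNondegenerate hM _ _)
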